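/- Let $p$ be a prime and let $(F,v)$ be a Henselian valued field of characteristic $p$. Let $D$ be a finite-dimensional division algebra with center $F$ whose degree $\sqrt{[D:F]}$ is a power of $p$, with a valuation $v$ extending that of $F$. For a division ring $E$ with $F\subseteq E\subseteq D$ write $\overline E$ and $\Gamma_E$ for its residue division ring and its value group. Assume that $D$ is semi-ramified with separable residue field: $\overline D$ is a field, separable over $\overline F$, and $[\overline D:\overline F]=|\Gamma_D:\Gamma_F|=\sqrt{[D:F]}$. Then $\theta_D:\Gamma_D/\Gamma_F\to G=\mathrm{Gal}(\overline D/\overline F)$, sending $v(x)+\Gamma_F$ to the automorphism $\overline d\mapsto\overline{xdx^{-1}}$, is an isomorphism. Choose a basis $\sigma_1,\dots,\sigma_r$ of the finite abelian group $G$ (so $G=\langle\sigma_1\rangle\times\dots\times\langle\sigma_r\rangle$) and $\pi_1,\dots,\pi_r\in D^*$ with $\theta_D(v(\pi_i)+\Gamma_F)=\sigma_i$. For $m\in\mathbb N^r$ put $\sigma^m=\sigma_1^{m_1}\cdots\sigma_r^{m_r}$, $\pi^m=\pi_1^{m_1}\cdots\pi_r^{m_r}$, and let $\bar u_{i,m}\in\overline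 D^{\,*}$ be the residue of $\pi_i\pi^m\pi_i^{-1}(\pi^m)^{-1}$. One says that $D$ is strongly degenerate if there are $m\in\mathbb N^r$ with $\sigma^m$ of prime order and $l,k_1,\dots,k_r\in\overline D^{\,*}$ such that $$\bar u_{i,m}=\sigma^m(k_i)\,k_i^{-1}\,\sigma_i(l)\,l^{-1}\qquad(1\le i\le r);$$ this does not depend on the choice of the $\sigma_i$ and $\pi_i$. Assume that $D$ is not strongly degenerate. Let $L\subseteq D$ be a subfield containing $F$ that is Galois over $F$. Then $L$ is inertial over $F$, that is, $[L:F]=[\overline L:\overline F]$ and $\overline L$ is separable over $\overline F$. In particular, $\mathrm{Gal}(L/F)$ is a homomorphic image of $\mathrm{Gal}(\overline D/\overline F)$. -/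

import Mathlib

/-! Valued division algebras. Valuations are written multiplicatively, as in Mathlib: the valuation
ring of `v` is `v.integer = {x | v x ≤ 1}` and its maximal ideal is `{x | v x < 1}`. -/

namespace ValuedDivAlg

section Residue

variable {A : Type*} [DivisionRing A] {Γ₀ : Type*} [LinearOrderedCommGroupWithZero Γ₀]

/-- The maximal ideal `M = {x | v x < 1}` of the valuation ring of a valued division ring. -/
abbrev maxIdeal (v : Valuation A Γ₀) : Ideal v.integer := v.ltIdeal 1

theorem mem_maxIdeal {v : Valuation A Γ₀} {x : v.integer} : x ∈ maxIdeal v ↔ v (x : A) < 1 := by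
  rfl

instance maxIdeal_isTwoSided (v : Valuation A Γ₀) : (maxIdeal v).IsTwoSided where
  mul_mem_of_left {a} b ha := by
    rw [mem_maxIdeal] at ha ⊢
    have hb : v (b : A) ≤ 1 := b.2
    simpa using mul_lt_one_of_lt_of_le ha hb

/-- The residue division ring of a valued division ring. -/
abbrev Residue (v : Valuation A Γ₀) : Type _ := v.integer ⧸ maxIdeal v

/-- The reduction map from the valuation ring to the residue division ring. -/
abbrev residue (v : Valuation A Γ₀) : v.integer →+* Residue v := Ideal.Quotient.mk (maxIdeal v)

/-- The value group `Γ = v(Aˣ)`. -/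
abbrev valueGroup (v : Valuation A Γ₀) : Subgroup Γ₀ˣ := MonoidWithZeroHom.valueGroup v.toMonoidWithZeroHom

/-- Conjugation `d ↦ x d x⁻¹` on the valuation ring. -/
def conj (v : Valuation A Γ₀) (x : Aˣ) (d : v.integer) : v.integer :=
  ⟨(x : A) * d * ((x⁻¹ : Aˣ) : A), by
    have hd : v (d : A) ≤ 1 := d.2
    have hx : v (x : A) ≠ 0 := v.ne_zero_iff.2 x.ne_zero
    rw [Valuation.mem_integer_iff, map_mul, map_mul, Units.val_inv_eq_inv_val, map_inv₀,
      mul_right_comm, mul_inv_cancel₀ hx, one_mul]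
    exact hd⟩

/-- The commutator `x y x⁻¹ y⁻¹`, which has value `1`, as an element of the valuation ring. -/
def commInt (v : Valuation A Γ₀) (x y : Aˣ) : v.integer :=
  ⟨(x : A) * y * ((x⁻¹ : Aˣ) : A) * ((y⁻¹ : Aˣ) : A), by
    have hx : v (x : A) ≠ 0 := v.ne_zero_iff.2 x.ne_zero
    have hy : v (y : A) ≠ 0 := v.ne_zero_iff.2 y.ne_zero
    rw [Valuation.mem_integer_iff, map_mul, map_mul, map_mul, Units.val_inv_eq_inv_val,
      Units.val_inv_eq_inv_val, map_inv₀, map_inv₀, mul_right_comm (v (x : A)),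
      mul_inv_cancel₀ hx, one_mul, mul_inv_cancel₀ hy]⟩

end Residue

section Extension

variable (F : Type*) [Field F] {A : Type*} [DivisionRing A] [Algebra F A]
  {Γ₀ : Type*} [LinearOrderedCommGroupWithZero Γ₀]

/-- The restriction of a valuation on `A` to the base field `F`. -/
abbrev restr (v : Valuation A Γ₀) : Valuation F Γ₀ := v.comap (algebraMap F A)

/-- The inclusion of valuation rings. -/
def integerMap (v : Valuation A Γ₀) : (restr F v).integer →+* v.integer :=
  (algebraMap F A).restrict _ _ fun _ hx => hx

/-- The map induced on residue rings by the inclusion of valuation rings. -/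
def residueMap (v : Valuation A Γ₀) : Residue (restr F v) →+* Residue v :=
  Ideal.quotientMap (maxIdeal v) (integerMap F v) fun _ hx => hx

instance residueAlgebra (v : Valuation A Γ₀) : Algebra (Residue (restr F v)) (Residue v) :=
  (residueMap F v).toAlgebra' <| by
    intro c x
    obtain ⟨c, rfl⟩ := Ideal.Quotient.mk_surjective c
    obtain ⟨x, rfl⟩ := Ideal.Quotient.mk_surjective x
    refine congrArg (residue v) (?_ : integerMap F v c * x = x * integerMap F v c)
    exact Subtype.ext (Algebra.commutes (c : F) (x : A))

/-- The group of automorphisms of the residue division ring of `A` over the residue field of `F`. -/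
abbrev ResidueGal (v : Valuation A Γ₀) : Type _ := Residue v ≃ₐ[Residue (restr F v)] Residue v

/-- `(A, v)` is inertial over `F`: the degree of the residue extension equals `[A : F] < ∞`, and the
residue extension is separable. -/
def IsInertial (v : Valuation A Γ₀) : Prop :=
  FiniteDimensional F A ∧
  Module.finrank F A = Module.finrank (Residue (restr F v)) (Residue v) ∧
  Algebra.IsSeparable (Residue (restr F v)) (Residue v)

/-- `(A, v)` is semi-ramified over `F`: the residue ring of `A` is a field, and
`[Ā : F̄] = |Γ_A : Γ_F| = √[A : F]`. -/
def IsSemiramified (v : Valuation A Γ₀) : Prop :=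
  IsField (Residue v) ∧
  Module.finrank (Residue (restr F v)) (Residue v) =
    (valueGroup (restr F v)).relIndex (valueGroup v) ∧
  Module.finrank (Residue (restr F v)) (Residue v) ^ 2 = Module.finrank F A

end Extension

/-- The ordered product `x₁ ^ m₁ ⋯ xᵣ ^ mᵣ`. -/
def monomial {G : Type*} [Monoid G] {r : ℕ} (x : Fin r → G) (m : Fin r → ℕ) : G :=
  (List.ofFn fun i => x i ^ m i).prod

/-- `σ` is a basis of the finite abelian group `G`, i.e. `G = ⟨σ₁⟩ × ⋯ × ⟨σᵣ⟩`: the `σᵢ` commute and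
each element is `σ₁ ^ m₁ ⋯ σᵣ ^ mᵣ` for exactly one `m` with `0 ≤ mᵢ < |σᵢ|`. -/
def IsBasis {G : Type*} [Group G] {r : ℕ} (σ : Fin r → G) : Prop :=
  (∀ i j, Commute (σ i) (σ j)) ∧
  Function.Bijective fun m : (∀ i, Fin (orderOf (σ i))) => monomial σ fun i => (m i : ℕ)

section Degeneracy

variable (F : Type*) [Field F] {D : Type*} [DivisionRing D] [Algebra F D]
  {Γ₀ : Type*} [LinearOrderedCommGroupWithZero Γ₀]

/-- `θ_D(v(x) + Γ_F) = τ`, where `θ_D : Γ_D / Γ_F → Gal(D̄ / F̄)` is the homomorphism sending the class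
of `v(x)` to the automorphism of the residue field `D̄` induced by `d ↦ x d x⁻¹`. -/
def ThetaEq (v : Valuation D Γ₀) (x : Dˣ) (τ : ResidueGal F v) : Prop :=
  ∀ d : v.integer, τ (residue v d) = residue v (conj v x d)

/-- Strong degeneracy of the matrix attached to a basis `σ` of `Gal(D̄ / F̄)` and to elements `πᵢ`
of `Dˣ`: some `σ^m` has prime order and there are nonzero `l, k₁, …, kᵣ` in the residue field with
`ū_{i,m} = σ^m(kᵢ) kᵢ⁻¹ σᵢ(l) l⁻¹` for all `i`, where `ū_{i,m}` is the residue of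
`πᵢ π^m πᵢ⁻¹ (π^m)⁻¹`. -/
def MatrixStronglyDegenerate (v : Valuation D Γ₀) {r : ℕ} (σ : Fin r → ResidueGal F v)
    (π : Fin r → Dˣ) : Prop :=
  ∃ m : Fin r → ℕ, (orderOf (monomial σ m)).Prime ∧
    ∃ (l : (Residue v)ˣ) (k : Fin r → (Residue v)ˣ), ∀ i : Fin r,
      residue v (commInt v (π i) (monomial π m)) =
        monomial σ m (k i : Residue v) * (((k i)⁻¹ : (Residue v)ˣ) : Residue v) *
          σ i (l : Residue v) * ((l⁻¹ : (Residue v)ˣ) : Residue v)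

/-- `(D, v)` is strongly degenerate. The property does not depend on the choice of the basis `σ` and
of the lifts `π`; it is stated here for all choices, so that its negation asks for just one choice
whose matrix is not strongly degenerate. -/
def IsStronglyDegenerate (v : Valuation D Γ₀) : Prop :=
  ∀ (r : ℕ) (σ : Fin r → ResidueGal F v) (π : Fin r → Dˣ),
    IsBasis σ → (∀ i, ThetaEq F v (π i) (σ i)) → MatrixStronglyDegenerate F v σ π

end Degeneracy

end ValuedDivAlg

/-! Write `k ⊆ K` for the residue fields of `F ⊆ D`, `G = Gal(K/k)`, `θ : Dˣ → G` for the action by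
conjugation, `C` for the centralizer of `L`, and `L̄`, `C̄` for the residue fields. It suffices to
show `θ(L) = 1`, because `[L : F] = [L̄ : k] · |θ(L)|`.

That equality comes from squeezing. The fundamental inequality for `D / S`, with `[K : k]² = [D :
F]`, gives `[S : F] ≤ [S̄ : k] · |θ(S)|` for `S = L` and `S = C`. Since `[D : F] ≤ [L : F][C : F]`,
while `θ(L)` fixes `C̄` and `θ(C)` fixes `L̄`, all the inequalities are equalities, and `θ(C) =
Gal(K/L̄)` (`finrank_relations`). It follows that every element of `G` is induced by an `x`
normalizing `L` (`exists_mem_inducingPairs_theta_eq`).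

Suppose `θ(L) ≠ 1` and take `z ∈ L` with `θ(z)` of prime order. For `x` normalizing `L`, the residue
of `x z x⁻¹ z⁻¹` depends only on `θ(x)`: the ambiguity is a root of unity of `p`-power order in
characteristic `p`, hence trivial. So this residue is a 1-cocycle of `G` in `Kˣ`, a coboundary by
Hilbert 90 (`exists_commRes_eq_coboundary`). Replacing the normalizing elements by `πᵢ` and `z` by
`π^m` changes elements only by units and factors from `F`, and produces exactly the relation of
strong degeneracy.

Once `θ(L) = 1`, comparing the actions of the normalizer of `L` on `L` and on `K` gives the
surjection `G → Gal(L/F)`. -/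

namespace ValuedDivAlg

/-! ### Reduction maps onto abstract fields, and the action of `Dˣ` on the residue field. -/

open Polynomial

/-- A reduction map of the valued division algebra `(D, v)` onto the extension `K / k`: a function on
`D` which restricts to a surjective ring homomorphism from the valuation ring onto `K` with kernel the
maximal ideal, and which maps the valuation ring of `F` onto `k`. -/
structure Reduction (F : Type*) [Field F] {D : Type*} [DivisionRing D] [Algebra F D]
    {Γ₀ : Type*} [LinearOrderedCommGroupWithZero Γ₀] (v : Valuation D Γ₀)
    (k K : Type*) [Field k] [Field K] [Algebra k K] where
  toFun : D → K
  map_one : toFun 1 = 1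
  map_add : ∀ {x y : D}, v x ≤ 1 → v y ≤ 1 → toFun (x + y) = toFun x + toFun y
  map_mul : ∀ {x y : D}, v x ≤ 1 → v y ≤ 1 → toFun (x * y) = toFun x * toFun y
  eq_zero_iff : ∀ {x : D}, v x ≤ 1 → (toFun x = 0 ↔ v x < 1)
  surj : ∀ y : K, ∃ x : D, v x ≤ 1 ∧ toFun x = y
  mem_base_iff : ∀ y : K, y ∈ (algebraMap k K).range ↔
    ∃ c : F, v (algebraMap F D c) ≤ 1 ∧ toFun (algebraMap F D c) = y

namespace Reduction

variable {F : Type*} [Field F] {D : Type*} [DivisionRing D] [Algebra F D]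
    {Γ₀ : Type*} [LinearOrderedCommGroupWithZero Γ₀] {v : Valuation D Γ₀}
    {k K : Type*} [Field k] [Field K] [Algebra k K] (r : Reduction F v k K)

theorem map_zero : r.toFun 0 = 0 := by
  rw [r.eq_zero_iff (by simp)]; simp

theorem map_neg {x : D} (hx : v x ≤ 1) : r.toFun (-x) = - r.toFun x := by
  have := r.map_add hx (y := -x) (by rwa [Valuation.map_neg])
  rw [add_neg_cancel, r.map_zero] at this
  exact (neg_eq_of_add_eq_zero_right this.symm).symm

theorem map_sub {x y : D} (hx : v x ≤ 1) (hy : v y ≤ 1) :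
    r.toFun (x - y) = r.toFun x - r.toFun y := by
  rw [sub_eq_add_neg, r.map_add hx (by rwa [Valuation.map_neg]), r.map_neg hy, sub_eq_add_neg]

theorem map_sum {ι : Type*} (s : Finset ι) (f : ι → D) (hf : ∀ i ∈ s, v (f i) ≤ 1) :
    r.toFun (∑ i ∈ s, f i) = ∑ i ∈ s, r.toFun (f i) := by
  classical
  induction s using Finset.induction_on with
  | empty => simp [r.map_zero]
  | insert a s ha ih =>
    rw [Finset.sum_insert ha, Finset.sum_insert ha, r.map_add (hf a (by simp)),
      ih fun i hi => hf i (by simp [hi])]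
    exact v.map_sum_le fun i hi => hf i (by simp [hi])

theorem map_natCast (m : ℕ) : v (m : D) ≤ 1 ∧ r.toFun (m : D) = m := by
  induction m with
  | zero => simp [r.map_zero]
  | succ m ih =>
    push_cast
    refine ⟨v.map_add_le ih.1 (by simp), ?_⟩
    rw [r.map_add ih.1 (by simp), ih.2, r.map_one]

theorem eq_iff {x y : D} (hx : v x ≤ 1) (hy : v y ≤ 1) :
    r.toFun x = r.toFun y ↔ v (x - y) < 1 := by
  rw [← r.eq_zero_iff (v.map_sub_le hx hy), r.map_sub hx hy, sub_eq_zero]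

theorem ne_zero_iff {x : D} (hx : v x ≤ 1) : r.toFun x ≠ 0 ↔ v x = 1 := by
  rw [Ne, r.eq_zero_iff hx, not_lt]
  exact ⟨fun h => le_antisymm hx h, fun h => h.ge⟩

theorem map_inv {x : D} (hx : v x = 1) : r.toFun x⁻¹ = (r.toFun x)⁻¹ := by
  have h1 : v x⁻¹ ≤ 1 := by rw [map_inv₀, hx, inv_one]
  have h0 : x ≠ 0 := by rintro rfl; simp at hx
  have := r.map_mul hx.le h1
  rw [mul_inv_cancel₀ h0, r.map_one] at this
  exact eq_inv_of_mul_eq_one_right this.symm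

theorem _root_.Valuation.map_conj (v : Valuation D Γ₀) (x : Dˣ) (d : D) :
    v (x * d * (x⁻¹ : Dˣ)) = v d := by
  have hx : v (x : D) ≠ 0 := v.ne_zero_iff.2 x.ne_zero
  rw [_root_.map_mul, _root_.map_mul, Units.val_inv_eq_inv_val, map_inv₀, mul_right_comm,
    mul_inv_cancel₀ hx, one_mul]

/-- A lift of a residue class. -/
noncomputable def lift (y : K) : D := (r.surj y).choose

theorem v_lift (y : K) : v (r.lift y) ≤ 1 := (r.surj y).choose_spec.1

@[simp] theorem toFun_lift (y : K) : r.toFun (r.lift y) = y := (r.surj y).choose_spec.2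

theorem conj_congr (x : Dˣ) {d e : D} (hd : v d ≤ 1) (he : v e ≤ 1) (h : r.toFun d = r.toFun e) :
    r.toFun (x * d * (x⁻¹ : Dˣ)) = r.toFun (x * e * (x⁻¹ : Dˣ)) := by
  rw [r.eq_iff hd he] at h
  rwa [r.eq_iff (by rwa [v.map_conj]) (by rwa [v.map_conj]), ← sub_mul, ← mul_sub, v.map_conj]

/-- The residue of `x d x⁻¹`, as a function of the residue of `d`. -/
noncomputable def conjFun (x : Dˣ) (y : K) : K := r.toFun (x * r.lift y * (x⁻¹ : Dˣ))

theorem conjFun_toFun (x : Dˣ) {d : D} (hd : v d ≤ 1) :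
    r.conjFun x (r.toFun d) = r.toFun (x * d * (x⁻¹ : Dˣ)) :=
  r.conj_congr x (r.v_lift _) hd (r.toFun_lift _)

theorem conjFun_mul (x y : Dˣ) (a : K) : r.conjFun (x * y) a = r.conjFun x (r.conjFun y a) := by
  rw [conjFun, conjFun.eq_1 r y, r.conjFun_toFun x (by rw [v.map_conj]; exact r.v_lift _)]
  simp [mul_assoc]

theorem conjFun_one (a : K) : r.conjFun 1 a = a := by
  simp [conjFun]

/-- The homomorphism `Dˣ → Gal(K / k)` induced by conjugation. -/
noncomputable def theta : Dˣ →* (K ≃ₐ[k] K) where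
  toFun x :=
    { toFun := r.conjFun x
      invFun := r.conjFun x⁻¹
      left_inv := fun a => by rw [← conjFun_mul, inv_mul_cancel, conjFun_one]
      right_inv := fun a => by rw [← conjFun_mul, mul_inv_cancel, conjFun_one]
      map_mul' := fun a b => by
        obtain ⟨a, ha, rfl⟩ := r.surj a
        obtain ⟨b, hb, rfl⟩ := r.surj b
        rw [← r.map_mul ha hb, r.conjFun_toFun x (by rw [_root_.map_mul]; exact mul_le_one' ha hb),
          r.conjFun_toFun x ha, r.conjFun_toFun x hb,
          ← r.map_mul (by rwa [v.map_conj]) (by rwa [v.map_conj])]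
        simp [mul_assoc]
      map_add' := fun a b => by
        obtain ⟨a, ha, rfl⟩ := r.surj a
        obtain ⟨b, hb, rfl⟩ := r.surj b
        rw [← r.map_add ha hb, r.conjFun_toFun x (v.map_add_le ha hb),
          r.conjFun_toFun x ha, r.conjFun_toFun x hb,
          ← r.map_add (by rwa [v.map_conj]) (by rwa [v.map_conj])]
        simp [mul_add, add_mul]
      commutes' := fun a => by
        obtain ⟨c, hc, h⟩ := (r.mem_base_iff _).1 ⟨a, rfl⟩
        rw [← h, r.conjFun_toFun x hc, ← Algebra.commutes, mul_assoc, Units.mul_inv, mul_one] }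
  map_one' := by ext a; exact r.conjFun_one a
  map_mul' x y := by ext a; exact r.conjFun_mul x y a

theorem theta_toFun (x : Dˣ) {d : D} (hd : v d ≤ 1) :
    r.theta x (r.toFun d) = r.toFun (x * d * (x⁻¹ : Dˣ)) :=
  r.conjFun_toFun x hd

theorem theta_eq_one_of_v_eq_one {x : Dˣ} (hx : v (x : D) = 1) : r.theta x = 1 := by
  ext a
  obtain ⟨a, ha, rfl⟩ := r.surj a
  have h1 : v ((x⁻¹ : Dˣ) : D) ≤ 1 := by rw [Units.val_inv_eq_inv_val, map_inv₀, hx, inv_one]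
  rw [r.theta_toFun x ha, r.map_mul (by rw [_root_.map_mul]; exact mul_le_one' hx.le ha) h1,
    r.map_mul hx.le ha, mul_right_comm, ← r.map_mul hx.le h1, Units.mul_inv, r.map_one, one_mul]
  rfl

theorem theta_eq_one_of_commute {x : Dˣ} (hx : ∀ d : D, Commute (x : D) d) : r.theta x = 1 := by
  ext a
  obtain ⟨a, ha, rfl⟩ := r.surj a
  rw [r.theta_toFun x ha, (hx a).eq, mul_assoc, Units.mul_inv, mul_one]
  rfl

theorem theta_eq_of_v_eq {x y : Dˣ} (h : v (x : D) = v (y : D)) : r.theta x = r.theta y := by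
  have hy : v (y : D) ≠ 0 := v.ne_zero_iff.2 y.ne_zero
  have : r.theta (x * y⁻¹) = 1 := r.theta_eq_one_of_v_eq_one (by
    rw [Units.val_mul, _root_.map_mul, Units.val_inv_eq_inv_val, map_inv₀, h, mul_inv_cancel₀ hy])
  rwa [_root_.map_mul, _root_.map_inv, mul_inv_eq_one] at this

/-- If all `bᵢ` reduce to `y` then `∏ (X - bᵢ)` reduces to `(X - y) ^ d`. -/
theorem coeff_list_prod_X_sub_C {y : K} (l : List D) (hl : ∀ b ∈ l, v b ≤ 1 ∧ r.toFun b = y)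
    (i : ℕ) : v ((l.map fun b => X - C b).prod.coeff i) ≤ 1 ∧
      r.toFun ((l.map fun b => X - C b).prod.coeff i) = ((X - C y) ^ l.length).coeff i := by
  induction l generalizing i with
  | nil =>
    simp only [List.map_nil, List.prod_nil, List.length_nil, pow_zero, coeff_one]
    split_ifs <;> simp [r.map_zero, r.map_one]
  | cons b l ih =>
    have ih' := ih fun b hb => hl b (by simp [hb])
    obtain ⟨hb, rfl⟩ := hl b (by simp)
    have key (j : ℕ) : v (b * (l.map fun b => X - C b).prod.coeff j) ≤ 1 := by
      rw [_root_.map_mul]; exact mul_le_one' hb (ih' j).1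
    simp only [List.map_cons, List.prod_cons, List.length_cons, pow_succ', sub_mul, coeff_sub,
      coeff_C_mul]
    cases i with
    | zero =>
      simp only [coeff_X_mul_zero, zero_sub, Valuation.map_neg]
      exact ⟨key 0, by rw [r.map_neg (key 0), r.map_mul hb (ih' 0).1, (ih' 0).2]⟩
    | succ i =>
      simp only [coeff_X_mul]
      exact ⟨v.map_sub_le (ih' i).1 (key _), by
        rw [r.map_sub (ih' i).1 (key _), r.map_mul hb (ih' _).1, (ih' _).2, (ih' _).2]⟩

/-- The minimal polynomial of `y` divides `(X - y) ^ d` and is squarefree by separability, so it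
divides `X - y` and has degree one. -/
theorem _root_.mem_range_algebraMap_of_X_sub_C_pow_mem_lifts {k K : Type*} [Field k] [Field K]
    [Algebra k K] {y : K} (hy : IsSeparable k y) {d : ℕ} (hd : d ≠ 0)
    (h : ∀ i, ((X - C y) ^ d).coeff i ∈ (algebraMap k K).range) : y ∈ (algebraMap k K).range := by
  obtain ⟨q, hq⟩ : ∃ q : k[X], q.map (algebraMap k K) = (X - C y) ^ d :=
    (lifts_iff_coeff_lifts _).2 fun i => h i
  have hdvd : minpoly k y ∣ q := minpoly.dvd k y (by
    rw [aeval_def, ← eval_map, hq]; simp [hd])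
  have h2 : (minpoly k y).map (algebraMap k K) ∣ X - C y := by
    refine ((Separable.squarefree (Separable.map hy)).isRadical) d _ ?_
    rw [← hq]; exact Polynomial.map_dvd _ hdvd
  refine minpoly.mem_range_of_degree_eq_one k y (le_antisymm ?_ ?_)
  · simpa using degree_le_of_dvd h2 (X_sub_C_ne_zero y)
  · exact Nat.WithBot.one_le_iff_zero_lt.2 (minpoly.degree_pos hy.isIntegral)

/-- The reduction of a split polynomial with coefficients in `F` and all its roots congruent. -/
theorem mem_base_of_list_prod {y : K} (hy : IsSeparable k y) (l : List D) (hne : l ≠ [])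
    (hl : ∀ b ∈ l, v b ≤ 1 ∧ r.toFun b = y)
    (hc : ∀ i, (l.map fun b => X - C b).prod.coeff i ∈ (algebraMap F D).range) :
    y ∈ (algebraMap k K).range := by
  refine mem_range_algebraMap_of_X_sub_C_pow_mem_lifts hy
    (List.length_pos_iff.2 hne).ne' fun i => ?_
  obtain ⟨c, hc⟩ := hc i
  obtain ⟨h1, h2⟩ := r.coeff_list_prod_X_sub_C l hl i
  rw [← hc] at h1 h2
  exact (r.mem_base_iff _).2 ⟨c, h1, h2⟩

end Reduction
end ValuedDivAlg

/-! ### Wedderburn factorization; `K / k` is Galois and `θ` is surjective. -/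

namespace ValuedDivAlg

open Polynomial

section Wedderburn

variable {D : Type*} [DivisionRing D]

/-- Division with the linear factor on the right: `eval` puts coefficients on the left of powers, so
it kills left multiples of `X - b`. -/
theorem exists_eq_mul_X_sub_C_add_C (Q : D[X]) (b : D) :
    ∃ (P : D[X]) (c : D), Q = P * (X - C b) + C c := by
  induction Q using Polynomial.induction_on with
  | C a => exact ⟨0, a, by simp⟩
  | add p q hp hq =>
    obtain ⟨P, c, rfl⟩ := hp
    obtain ⟨P', c', rfl⟩ := hq
    exact ⟨P + P', c + c', by rw [add_mul, C_add]; abel⟩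
  | monomial n a ih =>
    obtain ⟨P, c, h⟩ := ih
    refine ⟨X * P + C c, c * b, ?_⟩
    rw [pow_succ, ← mul_assoc, h, ← X_mul, C_mul]
    simp only [mul_add, add_mul, mul_sub, mul_assoc, X_mul_C]
    abel

/-- Substitute for multiplicativity of evaluation over a noncommutative ring: `P` is `P(a)` modulo
the left ideal of multiples of `X - a`. -/
theorem eval_mul_C_eval (a : D) (Q P : D[X]) :
    (Q * C (P.eval a)).eval a = (Q * P).eval a := by
  obtain ⟨P', c, rfl⟩ := exists_eq_mul_X_sub_C_add_C P a
  rw [mul_add, eval_add, ← mul_assoc, eval_mul_X_sub_C, eval_add, eval_mul_X_sub_C, eval_C]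
  simp

theorem monic_and_natDegree_list_prod_X_sub_C (l : List D) :
    (l.map fun b => X - C b).prod.Monic ∧ (l.map fun b => X - C b).prod.natDegree = l.length := by
  induction l with
  | nil => simp
  | cons b l ih =>
    refine ⟨(monic_X_sub_C b).mul ih.1, ?_⟩
    rw [List.map_cons, List.prod_cons, (monic_X_sub_C b).natDegree_mul ih.1, ih.2,
      natDegree_X_sub_C, List.length_cons, add_comm]

/-- A left multiple of `X - w a w⁻¹` is what vanishes at `w a w⁻¹`. -/
theorem exists_eq_mul_X_sub_C_conj {a w : D} (hw : w ≠ 0) {Q : D[X]} (h : (Q * C w).eval a = 0) :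
    ∃ P, Q = P * (X - C (w * a * w⁻¹)) := by
  obtain ⟨P, c, rfl⟩ := exists_eq_mul_X_sub_C_add_C Q (w * a * w⁻¹)
  have : (P * (X - C (w * a * w⁻¹)) + C c) * C w = P * C w * (X - C a) + C (c * w) := by
    simp only [add_mul, mul_sub, sub_mul, mul_assoc, X_mul_C, ← C_mul, inv_mul_cancel₀ hw, mul_one]
  rw [this, eval_add, eval_mul_X_sub_C, eval_C, zero_add, mul_eq_zero_iff_right hw] at h
  exact ⟨P, by rw [h, C_0, add_zero]⟩

variable (F : Type*) [Field F] [Algebra F D] [FiniteDimensional F D] [Algebra.IsCentral F D]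

/-- Wedderburn's factorisation theorem: over `D` the minimal polynomial of `a` over the center is a
product of linear factors `X - b`, with each `b` a conjugate of `a`. -/
theorem exists_list_prod_X_sub_C_conj (a : D) : ∃ l : List D, l ≠ [] ∧
    (∀ b ∈ l, ∃ w : Dˣ, b = w * a * (w⁻¹ : Dˣ)) ∧
    ∀ i, (l.map fun b => X - C b).prod.coeff i ∈ (algebraMap F D).range := by
  classical
  -- For `y ≠ 0`, `(Q * C y).eval a = Q(y a y⁻¹) y`, so `V Q` means that `Q` vanishes on the whole
  -- conjugacy class of `a`. A monic `Q` of least degree with this property will be factored.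
  let V (Q : D[X]) : Prop := ∀ y : D, (Q * C y).eval a = 0
  have hex : ∃ n, ∃ Q : D[X], Q ≠ 0 ∧ V Q ∧ Q.natDegree = n := by
    refine ⟨_, (minpoly F a).map (algebraMap F D), ?_, fun y => ?_, rfl⟩
    · exact ((minpoly.monic (Algebra.IsIntegral.isIntegral a)).map _).ne_zero
    · have h : (minpoly F a).map (algebraMap F D) * C y = C y * (minpoly F a).map (algebraMap F D) := by
        ext i
        simp [Algebra.commutes]
      rw [h, eval_C_mul, eval_map_algebraMap, minpoly.aeval, mul_zero]
  obtain ⟨Q₀, hQ₀, hV₀, hdeg₀⟩ := Nat.find_spec hex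
  have hmin (R : D[X]) (hR : V R) (hd : R.natDegree < Nat.find hex) : R = 0 := by
    by_contra h0
    exact Nat.find_min hex hd ⟨R, h0, hR, rfl⟩
  generalize Nat.find hex = n at hdeg₀ hmin
  obtain ⟨Q, hQm, hQV, hQd⟩ : ∃ Q : D[X], Q.Monic ∧ V Q ∧ Q.natDegree = n := by
    have h0 : Q₀.leadingCoeff ≠ 0 := leadingCoeff_ne_zero.2 hQ₀
    refine ⟨C Q₀.leadingCoeff⁻¹ * Q₀, ?_, fun y => ?_, ?_⟩
    · rw [Monic, leadingCoeff_mul, leadingCoeff_C, inv_mul_cancel₀ h0]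
    · rw [mul_assoc, eval_C_mul, hV₀ y, mul_zero]
    · rw [natDegree_C_mul (inv_ne_zero h0), hdeg₀]
  have hcent (i : ℕ) : Q.coeff i ∈ (algebraMap F D).range := by
    have hc : Q.coeff i ∈ Subalgebra.center F D := by
      rw [Subalgebra.mem_center_iff]
      intro d
      -- The commutator also vanishes on the class, and its top coefficient cancels because `Q` is
      -- monic; minimality kills it.
      have h : C d * Q - Q * C d = 0 := by
        by_contra hne
        refine hne (hmin _ (fun y => ?_) ?_)
        · rw [sub_mul, eval_sub, mul_assoc, eval_C_mul, hQV, mul_assoc, ← C_mul, hQV]; simp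
        · have hle : (C d * Q - Q * C d).natDegree ≤ n := by
            refine (natDegree_sub_le _ _).trans (max_le ?_ ?_)
            · exact (natDegree_C_mul_le _ _).trans hQd.le
            · exact (natDegree_mul_C_le _ _).trans hQd.le
          refine lt_of_le_of_ne hle fun he => hne ?_
          rw [← leadingCoeff_eq_zero, leadingCoeff, he]
          have h1 : Q.coeff n = 1 := by rw [← hQd]; exact hQm
          simp [h1]
      have := congrArg (fun P => P.coeff i) h
      simpa [sub_eq_zero] using this
    obtain ⟨c, hc⟩ := Algebra.mem_bot.1 (Algebra.IsCentral.out hc)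
    exact ⟨c, hc⟩
  have hfac (j : ℕ) (hj : j ≤ n) : ∃ (l : List D) (R : D[X]), l.length = j ∧ R.Monic ∧
      (∀ b ∈ l, ∃ w : Dˣ, b = w * a * (w⁻¹ : Dˣ)) ∧ Q = R * (l.map fun b => X - C b).prod := by
    induction j with
    | zero => exact ⟨[], Q, rfl, hQm, by simp, by simp⟩
    | succ j ih =>
      obtain ⟨l, R, hl, hR, hconj, hQR⟩ := ih (by omega)
      obtain ⟨hPm, hPd⟩ := monic_and_natDegree_list_prod_X_sub_C l
      -- The product `P` of the factors found so far has degree below `n`, so it misses some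
      -- conjugate. With `w = (P * C y).eval a`, the next root is `w a w⁻¹`.
      obtain ⟨y, hy⟩ : ∃ y, ((l.map fun b => X - C b).prod * C y).eval a ≠ 0 := by
        by_contra! hall
        exact hPm.ne_zero (hmin _ hall (by omega))
      obtain ⟨P, rfl⟩ := exists_eq_mul_X_sub_C_conj (Q := R) hy (by
        rw [eval_mul_C_eval, ← mul_assoc, ← hQR, hQV])
      refine ⟨_ :: l, P, congrArg (· + 1) hl, (monic_X_sub_C _).of_mul_monic_right hR, ?_,
        by rw [hQR, List.map_cons, List.prod_cons, mul_assoc]⟩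
      · intro b hb
        rcases List.mem_cons.1 hb with rfl | hb
        · exact ⟨Units.mk0 _ hy, by simp⟩
        · exact hconj b hb
  obtain ⟨l, R, hl, hR, hconj, hQR⟩ := hfac n le_rfl
  obtain ⟨hPm, hPd⟩ := monic_and_natDegree_list_prod_X_sub_C l
  have hR1 : R = 1 := by
    have := hR.natDegree_mul hPm
    rw [← hQR, hQd, hPd, hl] at this
    exact hR.natDegree_eq_zero.1 (by omega)
  refine ⟨l, ?_, hconj, fun i => ?_⟩
  · rintro rfl
    have := hQV 1
    rw [hQR, hR1] at this
    simp at this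
  · rw [← one_mul (List.prod _), ← hR1, ← hQR]; exact hcent i

end Wedderburn

namespace Reduction

variable {F : Type*} [Field F] {D : Type*} [DivisionRing D] [Algebra F D]
    {Γ₀ : Type*} [LinearOrderedCommGroupWithZero Γ₀] {v : Valuation D Γ₀}
    {k K : Type*} [Field k] [Field K] [Algebra k K] (r : Reduction F v k K)
    [FiniteDimensional F D] [Algebra.IsCentral F D] [Algebra.IsSeparable k K]

/-- The Wedderburn factors of a lift `a` of `y` have conjugates of `a` as roots, and these all
reduce to `y`. -/
theorem mem_base_of_forall_theta {y : K} (h : ∀ x, r.theta x y = y) :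
    y ∈ (algebraMap k K).range := by
  obtain ⟨a, ha, rfl⟩ := r.surj y
  obtain ⟨l, hne, hconj, hc⟩ := exists_list_prod_X_sub_C_conj F a
  refine r.mem_base_of_list_prod (Algebra.IsSeparable.isSeparable k _) l hne (fun b hb => ?_) hc
  obtain ⟨w, rfl⟩ := hconj b hb
  exact ⟨by rwa [v.map_conj], by rw [← r.theta_toFun w ha, h]⟩

theorem fixedField_range_theta : IntermediateField.fixedField r.theta.range = ⊥ := by
  refine eq_bot_iff.2 fun y hy => ?_
  rw [IntermediateField.mem_fixedField_iff] at hy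
  exact IntermediateField.mem_bot.2 (r.mem_base_of_forall_theta fun x => hy _ ⟨x, rfl⟩)

theorem theta_surjective [FiniteDimensional k K] : Function.Surjective r.theta := by
  rw [← MonoidHom.range_eq_top, ← IntermediateField.fixingSubgroup_fixedField r.theta.range,
    r.fixedField_range_theta, IntermediateField.fixingSubgroup_bot]

theorem isGalois (r : Reduction F v k K) [FiniteDimensional k K] : IsGalois k K := by
  refine IsGalois.of_fixedField_eq_bot k K ?_
  rw [← MonoidHom.range_eq_top.2 r.theta_surjective, r.fixedField_range_theta]

end Reduction

end ValuedDivAlg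

/-! ### The fundamental inequality. -/

namespace ValuedDivAlg

theorem _root_.Valuation.eq_zero_of_sum_eq_zero_of_injOn {D : Type*} [DivisionRing D]
    {Γ₀ : Type*} [LinearOrderedCommGroupWithZero Γ₀] (v : Valuation D Γ₀) {ι : Type*} [Fintype ι]
    {z : ι → D} (hz : ∑ i, z i = 0) (h : ∀ i j, z i ≠ 0 → v (z i) = v (z j) → i = j) (i : ι) :
    z i = 0 := by
  classical
  by_contra hi
  obtain ⟨m, -, hm⟩ := Finset.exists_max_image Finset.univ (fun i => v (z i)) ⟨i, Finset.mem_univ i⟩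
  have hm0 : v (z m) ≠ 0 := fun h0 => by
    have := hm i (Finset.mem_univ i)
    rw [h0, le_zero_iff, v.zero_iff] at this
    exact hi this
  rw [← Finset.add_sum_erase _ _ (Finset.mem_univ m), add_eq_zero_iff_eq_neg] at hz
  have hlt : v (∑ x ∈ Finset.univ.erase m, z x) < v (z m) := by
    refine v.map_sum_lt hm0 fun j hj => lt_of_le_of_ne (hm j (Finset.mem_univ j)) fun he => ?_
    exact (Finset.mem_erase.1 hj).1 (h m j (v.ne_zero_iff.1 hm0) he.symm).symm
  rw [hz, Valuation.map_neg] at hlt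
  exact lt_irrefl _ hlt

namespace Reduction

variable {F : Type*} [Field F] {D : Type*} [DivisionRing D] [Algebra F D]
    {Γ₀ : Type*} [LinearOrderedCommGroupWithZero Γ₀] {v : Valuation D Γ₀}
    {k K : Type*} [Field k] [Field K] [Algebra k K] (r : Reduction F v k K)

/-- The residue field of a division subalgebra, inside the residue field of `D`. -/
def resField (S : Subalgebra F D) (hS : ∀ x ∈ S, x⁻¹ ∈ S) : IntermediateField k K where
  carrier := {y | ∃ s ∈ S, v s ≤ 1 ∧ r.toFun s = y}
  mul_mem' := by
    rintro _ _ ⟨s, hs, hvs, rfl⟩ ⟨t, ht, hvt, rfl⟩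
    exact ⟨s * t, mul_mem hs ht, by rw [_root_.map_mul]; exact mul_le_one' hvs hvt,
      r.map_mul hvs hvt⟩
  add_mem' := by
    rintro _ _ ⟨s, hs, hvs, rfl⟩ ⟨t, ht, hvt, rfl⟩
    exact ⟨s + t, add_mem hs ht, v.map_add_le hvs hvt, r.map_add hvs hvt⟩
  algebraMap_mem' := fun c => by
    obtain ⟨c, hc, h⟩ := (r.mem_base_iff _).1 ⟨c, rfl⟩
    exact ⟨_, S.algebraMap_mem c, hc, h⟩
  inv_mem' := by
    rintro _ ⟨s, hs, hvs, rfl⟩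
    by_cases h : r.toFun s = 0
    · exact ⟨0, zero_mem S, by simp, by rw [h, inv_zero, r.map_zero]⟩
    · replace h := (r.ne_zero_iff hvs).1 h
      exact ⟨s⁻¹, hS s hs, by rw [map_inv₀, h, inv_one], r.map_inv h⟩

/-- The image in `Gal(K / k)` of the units of a division subalgebra. -/
def thetaGroup (S : Subalgebra F D) (hS : ∀ x ∈ S, x⁻¹ ∈ S) : Subgroup (K ≃ₐ[k] K) where
  carrier := {g | ∃ x : Dˣ, (x : D) ∈ S ∧ r.theta x = g}
  mul_mem' := by
    rintro _ _ ⟨x, hx, rfl⟩ ⟨y, hy, rfl⟩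
    exact ⟨x * y, mul_mem hx hy, _root_.map_mul _ _ _⟩
  one_mem' := ⟨1, one_mem S, _root_.map_one _⟩
  inv_mem' := by
    rintro _ ⟨x, hx, rfl⟩
    exact ⟨x⁻¹, by rw [Units.val_inv_eq_inv_val]; exact hS _ hx, _root_.map_inv _ _⟩

section

variable {S : Subalgebra F D} {hS : ∀ x ∈ S, x⁻¹ ∈ S}

/-- Lifts of residues which are independent over the residue field of `S` are orthogonal over `S`. -/
theorem v_sum_mul_lift {ι : Type*} [Fintype ι] {b : ι → K}
    (hb : LinearIndependent (r.resField S hS) b) {s : ι → D} (hs : ∀ i, s i ∈ S)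
    {i₀ : ι} (hi₀ : ∀ i, v (s i) ≤ v (s i₀)) :
    v (∑ i, s i * r.lift (b i)) = v (s i₀) := by
  by_cases h0 : s i₀ = 0
  · have hall (i) : s i = 0 := by
      have := hi₀ i
      rwa [h0, _root_.map_zero, le_zero_iff, v.zero_iff] at this
    simp [hall]
  have hv0 : v (s i₀) ≠ 0 := v.ne_zero_iff.2 h0
  have hle (i) : v ((s i₀)⁻¹ * s i) ≤ 1 := by
    rw [_root_.map_mul, map_inv₀, inv_mul_le_iff₀ (zero_lt_iff.2 hv0), mul_one]
    exact hi₀ i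
  have hle' (i) : v ((s i₀)⁻¹ * s i * r.lift (b i)) ≤ 1 := by
    rw [_root_.map_mul]; exact mul_le_one' (hle i) (r.v_lift _)
  have hsum : ∑ i, s i * r.lift (b i) = s i₀ * ∑ i, (s i₀)⁻¹ * s i * r.lift (b i) := by
    simp [Finset.mul_sum, ← mul_assoc, mul_inv_cancel₀ h0]
  have hres : v (∑ i, (s i₀)⁻¹ * s i * r.lift (b i)) = 1 := by
    rw [← r.ne_zero_iff (v.map_sum_le fun i _ => hle' i), r.map_sum _ _ fun i _ => hle' i]
    intro hzero
    have := Fintype.linearIndependent_iff.1 hb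
      (fun i => ⟨r.toFun ((s i₀)⁻¹ * s i), _, mul_mem (hS _ (hs i₀)) (hs i), hle i, rfl⟩) (by
        rw [← hzero]
        refine Finset.sum_congr rfl fun i _ => ?_
        rw [r.map_mul (hle i) (r.v_lift _), toFun_lift]
        rfl) i₀
    rw [Subtype.ext_iff] at this
    simp [inv_mul_cancel₀ h0, r.map_one] at this
  rw [hsum, _root_.map_mul, hres, mul_one]

variable (S hS) in
/-- The fundamental inequality for the extension `D / S`. -/
theorem finrank_mul_index_le [FiniteDimensional F D] [FiniteDimensional k K]
    (hsurj : Function.Surjective r.theta) :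
    Module.finrank (r.resField S hS) K * (r.thetaGroup S hS).index ≤ Module.finrank S D := by
  classical
  let _ : DivisionRing S := divisionRingOfFiniteDimensional F S
  let b := Module.finBasis (r.resField S hS) K
  let Q := (K ≃ₐ[k] K) ⧸ r.thetaGroup S hS
  let _ : Fintype Q := Fintype.ofFinite Q
  -- The quotient consists of left cosets, whereas `S` multiplies on the left; inverting the
  -- representatives passes to right cosets.
  choose t ht using fun q : Q => hsurj (q.out)⁻¹
  -- Since `θ` depends only on the value, elements of `S t_q` for different cosets have different
  -- values.
  have hdisj (q q' : Q) (s s' : D) (hs : s ∈ S) (hs' : s' ∈ S) (h0 : s * t q ≠ 0)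
      (h : v (s * t q) = v (s' * t q')) : q = q' := by
    have hs0 : s ≠ 0 := left_ne_zero_of_mul h0
    have hs0' : s' ≠ 0 := by
      rintro rfl
      rw [zero_mul, _root_.map_zero, v.zero_iff] at h
      exact h0 h
    have := r.theta_eq_of_v_eq (x := Units.mk0 s hs0 * t q) (y := Units.mk0 s' hs0' * t q') h
    rw [_root_.map_mul, _root_.map_mul, ht, ht] at this
    rw [← QuotientGroup.out_eq' q, ← QuotientGroup.out_eq' q', QuotientGroup.eq]
    have h2 : (Quotient.out q)⁻¹ * Quotient.out q' =
        (r.theta (Units.mk0 s hs0))⁻¹ * r.theta (Units.mk0 s' hs0') := by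
      rw [eq_inv_mul_iff_mul_eq, ← mul_assoc, this, inv_mul_cancel_right]
    rw [h2]
    exact mul_mem (inv_mem ⟨_, hs, rfl⟩) ⟨_, hs', rfl⟩
  have hli : LinearIndependent S fun x : Fin _ × Q => r.lift (b x.1) * (t x.2 : D) := by
    rw [Fintype.linearIndependent_iff]
    intro g hg
    have hval (q : Q) : ∃ i, v (∑ i, (g (i, q) : D) * r.lift (b i)) = v (g (i, q) : D) ∧
        ∀ j, v (g (j, q) : D) ≤ v (g (i, q) : D) := by
      obtain ⟨i, -, hi⟩ := Finset.exists_max_image Finset.univ (fun i => v (g (i, q) : D))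
        ⟨⟨0, Module.finrank_pos⟩, Finset.mem_univ _⟩
      have hi' := fun j => hi j (Finset.mem_univ j)
      exact ⟨i, r.v_sum_mul_lift b.linearIndependent (fun j => (g (j, q)).2) hi', hi'⟩
    have hz : ∑ q : Q, (∑ i, (g (i, q) : D) * r.lift (b i)) * t q = 0 := by
      rw [← hg, Fintype.sum_prod_type_right]
      refine Finset.sum_congr rfl fun q _ => ?_
      rw [Finset.sum_mul]
      refine Finset.sum_congr rfl fun i _ => ?_
      rw [mul_assoc]
      rfl
    rintro ⟨j, q⟩
    have hq := v.eq_zero_of_sum_eq_zero_of_injOn hz (fun q q' h0 h => by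
      obtain ⟨i, hi, -⟩ := hval q
      obtain ⟨i', hi', -⟩ := hval q'
      refine hdisj q q' _ _ (g (i, q)).2 (g (i', q')).2 ?_ ?_
      · rwa [← v.ne_zero_iff, _root_.map_mul, ← hi, ← _root_.map_mul, v.ne_zero_iff]
      · rwa [_root_.map_mul, ← hi, _root_.map_mul, ← hi', ← _root_.map_mul, ← _root_.map_mul]) q
    obtain ⟨i, hi, hmax⟩ := hval q
    rw [mul_eq_zero_iff_right (t q).ne_zero] at hq
    rw [hq, _root_.map_zero] at hi
    have := hmax j
    rw [← hi, le_zero_iff, v.zero_iff] at this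
    exact Subtype.ext this
  have hfin : Module.Finite S D := Module.Finite.of_restrictScalars_finite F S D
  have := hli.fintype_card_le_finrank
  rwa [Fintype.card_prod, Fintype.card_fin, ← Nat.card_eq_fintype_card] at this

variable (S hS) in
-- Divide `[D : F] = [K : k]²` by the lower bound for `[D : S]` given by the fundamental inequality.
theorem finrank_le_finrank_resField_mul_card [FiniteDimensional F D] [FiniteDimensional k K]
    [IsGalois k K] (hsurj : Function.Surjective r.theta)
    (hn : Module.finrank k K ^ 2 = Module.finrank F D) :
    Module.finrank F S ≤ Module.finrank k (r.resField S hS) * Nat.card (r.thetaGroup S hS) := by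
  have h1 := r.finrank_mul_index_le S hS hsurj
  have h2 : Module.finrank F S * Module.finrank S D = Module.finrank F D := by
    let _ : DivisionRing S := divisionRingOfFiniteDimensional F S
    exact Module.finrank_mul_finrank F S D
  have h3 := Module.finrank_mul_finrank k (r.resField S hS) K
  have h4 := (r.thetaGroup S hS).card_mul_index
  rw [IsGalois.card_aut_eq_finrank] at h4
  have hpos : 0 < Module.finrank (r.resField S hS) K * (r.thetaGroup S hS).index :=
    Nat.mul_pos Module.finrank_pos (Nat.pos_of_ne_zero Subgroup.index_ne_zero_of_finite)
  refine Nat.le_of_mul_le_mul_right ?_ hpos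
  calc _ ≤ Module.finrank F S * Module.finrank S D := Nat.mul_le_mul_left _ h1
    _ = Module.finrank k K * Module.finrank k K := by rw [h2, ← hn, sq]
    _ = _ := by nth_rw 1 [← h3]; rw [← h4]; ring

end

end Reduction
end ValuedDivAlg

/-! ### Normalizer and centralizer of a Galois subfield. -/

namespace ValuedDivAlg

section Centralizer

variable {F : Type*} [Field F] {D : Type*} [DivisionRing D] [Algebra F D]
  {L : Type*} [Field L] [Algebra F L] (ι : L →ₐ[F] D)

/-- The pairs `(τ, x)` such that conjugation by `x` induces `τ` on `L`. -/
def inducingPairs : Subgroup ((L ≃ₐ[F] L) × Dˣ) where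
  carrier := {q | ∀ a, (q.2 : D) * ι a = ι (q.1 a) * q.2}
  mul_mem' := by
    intro q q' hq hq' a
    rw [Prod.snd_mul, Units.val_mul, mul_assoc, hq' a, ← mul_assoc, hq (q'.1 a), mul_assoc]
    rfl
  one_mem' := by intro a; simp
  inv_mem' := by
    intro q hq a
    have := hq (q.1⁻¹ a)
    rw [show q.1 (q.1⁻¹ a) = a from q.1.apply_symm_apply a] at this
    rw [Prod.snd_inv, Prod.fst_inv, Units.inv_mul_eq_iff_eq_mul, ← mul_assoc, this, mul_assoc,
      Units.mul_inv, mul_one]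

theorem conj_of_mem_inducingPairs {ι : L →ₐ[F] D} {q : (L ≃ₐ[F] L) × Dˣ}
    (hq : q ∈ inducingPairs ι) (a : L) : (q.2 : D) * ι a * (q.2⁻¹ : Dˣ) = ι (q.1 a) := by
  rw [hq a, mul_assoc, Units.mul_inv, mul_one]

/-- `D` is the sum of its `L`-`L`-bimodule components. -/
theorem exists_eq_sum_intertwining [FiniteDimensional F L] [IsGalois F L] (d : D) :
    ∃ f : (L ≃ₐ[F] L) → D, d = ∑ τ, f τ ∧ ∀ τ a, f τ * ι a = ι (τ a) * f τ := by
  classical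
  let b := Module.finBasis F L
  let a := b.traceDual
  have h (e : Module.Basis (Fin (Module.finrank F L)) F L) (x : L) :
      x = ∑ j, Algebra.trace F L (x * e j) • e.traceDual j := by
    conv_lhs => rw [← e.traceDual.sum_repr x]
    simp only [Module.Basis.traceDual_repr_apply, Algebra.traceForm_apply]
  have h1 (x : L) : x = ∑ j, Algebra.trace F L (x * a j) • b j := by
    conv_rhs => rw [← b.traceDual_traceDual]
    exact h a x
  have h2 (x : L) : x = ∑ j, Algebra.trace F L (b j * x) • a j := by
    simpa only [mul_comm] using h b x
  -- With trace-dual bases `a`, `b`, the tensor `∑ aᵢ ⊗ bᵢ` is the separability idempotent of `L /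
  -- F`. Twisting it by `τ` projects onto the `τ`-component; summing over `τ` leaves `∑ tr(aᵢ) bᵢ =
  -- 1`.
  refine ⟨fun τ => ∑ i, ι (τ (a i)) * d * ι (b i), ?_, fun τ c => ?_⟩
  · rw [Finset.sum_comm]
    have h (i) : ∑ τ : L ≃ₐ[F] L, ι (τ (a i)) * d * ι (b i) =
        d * ι (Algebra.trace F L (1 * a i) • b i) := by
      rw [← Finset.sum_mul, ← Finset.sum_mul, ← map_sum, one_mul,
        ← trace_eq_sum_automorphisms, AlgHom.commutes, Algebra.commutes, mul_assoc, Algebra.smul_def,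
        map_mul, AlgHom.commutes]
    simp only [h]
    rw [← Finset.mul_sum, ← map_sum, ← h1, map_one, mul_one]
  · have hb (i) : b i * c = ∑ j, Algebra.trace F L (b i * (c * a j)) • b j := by
      simpa only [mul_assoc] using h1 (b i * c)
    have ha (j) : c * a j = ∑ i, Algebra.trace F L (b i * (c * a j)) • a i := h2 _
    calc (∑ i, ι (τ (a i)) * d * ι (b i)) * ι c
        = ∑ i, ∑ j, Algebra.trace F L (b i * (c * a j)) • (ι (τ (a i)) * d * ι (b j)) := by
          rw [Finset.sum_mul]
          refine Finset.sum_congr rfl fun i _ => ?_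
          rw [mul_assoc, ← map_mul, hb i, map_sum, Finset.mul_sum]
          refine Finset.sum_congr rfl fun j _ => ?_
          rw [map_smul, mul_smul_comm]
      _ = ι (τ c) * ∑ j, ι (τ (a j)) * d * ι (b j) := by
          rw [Finset.sum_comm, Finset.mul_sum]
          refine Finset.sum_congr rfl fun j _ => ?_
          rw [← mul_assoc, ← mul_assoc, ← map_mul, ← map_mul]
          conv_rhs => rw [ha j, map_sum, map_sum, Finset.sum_mul, Finset.sum_mul]
          refine Finset.sum_congr rfl fun i _ => ?_
          rw [map_smul, map_smul, smul_mul_assoc, smul_mul_assoc]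

/-- A direct substitute for Skolem–Noether. Every nonzero component of an element of `D` is a unit
inducing its own `τ`, so an `a ∈ L` fixed by all induced automorphisms is central, hence in `F`;
then Galois theory applies. -/
theorem exists_mem_inducingPairs [FiniteDimensional F L] [IsGalois F L] [Algebra.IsCentral F D]
    (τ : L ≃ₐ[F] L) : ∃ x : Dˣ, (τ, x) ∈ inducingPairs ι := by
  let H : Subgroup (L ≃ₐ[F] L) := (inducingPairs ι).map (MonoidHom.fst _ _)
  suffices h : H = ⊤ by
    obtain ⟨⟨τ', x⟩, hx, rfl⟩ : τ ∈ H := h ▸ Subgroup.mem_top τ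
    exact ⟨x, hx⟩
  rw [← IntermediateField.fixingSubgroup_fixedField H, ← IntermediateField.fixingSubgroup_bot]
  congr 1
  refine eq_bot_iff.2 fun a ha => ?_
  rw [IntermediateField.mem_fixedField_iff] at ha
  have hc : ι a ∈ Subalgebra.center F D := by
    rw [Subalgebra.mem_center_iff]
    intro d
    obtain ⟨f, rfl, hf⟩ := exists_eq_sum_intertwining ι d
    rw [Finset.sum_mul, Finset.mul_sum]
    refine Finset.sum_congr rfl fun ρ _ => ?_
    by_cases h0 : f ρ = 0
    · rw [h0, zero_mul, mul_zero]
    · rw [hf, ha ρ ⟨(ρ, Units.mk0 _ h0), hf ρ, rfl⟩]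
  obtain ⟨c, hc⟩ := Algebra.mem_bot.1 (Algebra.IsCentral.out hc)
  exact IntermediateField.mem_bot.2 ⟨c, ι.injective ((ι.commutes c).trans hc)⟩

/-- The centralizer of `L` in `D`. -/
abbrev centralizerRange : Subalgebra F D := Subalgebra.centralizer F (Set.range ι)

theorem inv_mem_centralizerRange (x : D) (hx : x ∈ centralizerRange ι) :
    x⁻¹ ∈ centralizerRange ι := by
  rw [Subalgebra.mem_centralizer_iff F] at hx ⊢
  exact fun g hg => (Commute.inv_right₀ (hx g hg : Commute g x)).eq

theorem inv_mem_range (x : D) (hx : x ∈ ι.range) : x⁻¹ ∈ ι.range := by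
  obtain ⟨a, rfl⟩ := hx
  exact ⟨a⁻¹, map_inv₀ ι a⟩

/-- The `τ`-component of `D` lies in `x_τ C`, where `x_τ` is any unit inducing `τ`, so `D` is the
sum of `[L : F]` translates of `C`. -/
theorem finrank_le_finrank_mul_finrank_centralizerRange [FiniteDimensional F D]
    [FiniteDimensional F L] [IsGalois F L] [Algebra.IsCentral F D] :
    Module.finrank F D ≤ Module.finrank F L * Module.finrank F (centralizerRange ι) := by
  choose x hx using exists_mem_inducingPairs ι
  let T : ((L ≃ₐ[F] L) → centralizerRange ι) →ₗ[F] D :=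
    ∑ τ, (LinearMap.mulLeft F (x τ : D)) ∘ₗ (centralizerRange ι).val.toLinearMap ∘ₗ LinearMap.proj τ
  have hT : Function.Surjective T := by
    intro d
    obtain ⟨f, rfl, hf⟩ := exists_eq_sum_intertwining ι d
    refine ⟨fun τ => ⟨(x τ : D)⁻¹ * f τ, ?_⟩, ?_⟩
    · rw [Subalgebra.mem_centralizer_iff F]
      rintro _ ⟨a, rfl⟩
      have h := (inducingPairs ι).inv_mem (hx τ) (τ a)
      rw [Prod.snd_inv, Prod.fst_inv, show (τ⁻¹ : L ≃ₐ[F] L) (τ a) = a from τ.symm_apply_apply a,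
        Units.val_inv_eq_inv_val] at h
      rw [← mul_assoc, ← h, mul_assoc, ← hf, mul_assoc]
    · simp [T, LinearMap.sum_apply]
  have := LinearMap.finrank_le_finrank_of_surjective hT
  rw [Module.finrank_pi_fintype, Finset.sum_const, smul_eq_mul, Finset.card_univ,
    ← Nat.card_eq_fintype_card, IsGalois.card_aut_eq_finrank] at this
  exact this

end Centralizer

end ValuedDivAlg

/-! ### Degree equalities, and automorphisms of `K` induced by the normalizer. -/

namespace ValuedDivAlg

open Polynomial

theorem mem_valueGroup_iff {A : Type*} [DivisionRing A] {Γ₀ : Type*}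
    [LinearOrderedCommGroupWithZero Γ₀] (v : Valuation A Γ₀) {g : Γ₀ˣ} :
    g ∈ valueGroup v ↔ ∃ a, v a = g := by
  rw [← SetLike.mem_coe, ← MonoidWithZeroHom.valueMonoid_eq_valueGroup']
  rfl

/-- The product of the `X - τ a` over the Galois group has coefficients in the base field. -/
theorem coeff_prod_X_sub_C_mem_range {F L : Type*} [Field F] [Field L] [Algebra F L]
    [FiniteDimensional F L] [IsGalois F L] (a : L) (i : ℕ) :
    (∏ τ : L ≃ₐ[F] L, (X - C (τ a))).coeff i ∈ (algebraMap F L).range := by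
  refine IntermediateField.mem_bot.1 ((IsGalois.mem_bot_iff_fixed _).2 fun σ => ?_)
  have h : (∏ τ : L ≃ₐ[F] L, (X - C (τ a))).map (σ : L →+* L) = ∏ τ : L ≃ₐ[F] L, (X - C (τ a)) := by
    rw [Polynomial.map_prod]
    refine Fintype.prod_equiv (Equiv.mulLeft σ) _ _ fun τ => ?_
    simp
  conv_rhs => rw [← h, coeff_map]
  rfl

namespace Reduction

variable {F : Type*} [Field F] {D : Type*} [DivisionRing D] [Algebra F D]
    {Γ₀ : Type*} [LinearOrderedCommGroupWithZero Γ₀] {v : Valuation D Γ₀}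
    {k K : Type*} [Field k] [Field K] [Algebra k K] (r : Reduction F v k K)
    [FiniteDimensional F D]

theorem finiteDimensional_of_sq_finrank
    (hn : Module.finrank k K ^ 2 = Module.finrank F D) : FiniteDimensional k K := by
  refine FiniteDimensional.of_finrank_pos (Nat.pos_of_ne_zero fun h0 => ?_)
  rw [h0, zero_pow two_ne_zero] at hn
  exact Module.finrank_pos.ne hn

variable [Algebra.IsCentral F D]

/-- When `[D̄ : F̄] = |Γ_D : Γ_F|`, the homomorphism `θ` is injective on `Γ_D / Γ_F`. -/
theorem exists_v_eq_of_theta_eq [Algebra.IsSeparable k K] [FiniteDimensional k K]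
    (hindex : Module.finrank k K = (valueGroup (restr F v)).relIndex (valueGroup v))
    {x y : Dˣ} (h : r.theta x = r.theta y) :
    ∃ c : F, v (x : D) = v (algebraMap F D c) * v (y : D) := by
  have := r.isGalois
  let φ : Dˣ →* Γ₀ˣ := Units.map (v : D →* Γ₀)
  let A : Subgroup Dˣ := (valueGroup (restr F v)).comap φ
  have hA {x : Dˣ} : x ∈ A ↔ ∃ c : F, v (algebraMap F D c) = v (x : D) := mem_valueGroup_iff _
  have hrange : φ.range = valueGroup v := by
    ext g
    rw [mem_valueGroup_iff]
    refine ⟨fun ⟨x, hx⟩ => ⟨x, congrArg Units.val hx⟩, fun ⟨x, hx⟩ => ?_⟩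
    have hx0 : x ≠ 0 := v.ne_zero_iff.1 (hx ▸ g.ne_zero)
    exact ⟨Units.mk0 x hx0, Units.ext hx⟩
  have hle : A ≤ r.theta.ker := by
    intro x hx
    obtain ⟨c, hc⟩ := hA.1 hx
    have hc0 : algebraMap F D c ≠ 0 := v.ne_zero_iff.1 (hc ▸ v.ne_zero_iff.2 x.ne_zero)
    rw [MonoidHom.mem_ker, r.theta_eq_of_v_eq (x := x) (y := Units.mk0 _ hc0) hc.symm]
    exact r.theta_eq_one_of_commute fun d => Algebra.commutes c d
  -- `A`, the preimage of `Γ_F`, lies in `ker θ`; both have index `[K : k]`, so they coincide.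
  have hindex : A.index = r.theta.ker.index := by
    rw [Subgroup.index_comap, hrange, ← hindex, Subgroup.index_ker,
      MonoidHom.range_eq_top.2 r.theta_surjective, ← IsGalois.card_aut_eq_finrank,
      Subgroup.card_top]
  have hker : r.theta.ker.index ≠ 0 := by
    rw [Subgroup.index_ker]; exact Nat.card_pos.ne'
  have hAker : r.theta.ker ≤ A := by
    rw [← Subgroup.relIndex_eq_one]
    have := Subgroup.relIndex_mul_index hle
    rw [hindex] at this
    exact Nat.eq_of_mul_eq_mul_right (Nat.pos_of_ne_zero hker) (by rw [this, one_mul])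
  obtain ⟨c, hc⟩ := hA.1 (hAker (show x * y⁻¹ ∈ r.theta.ker by
    rw [MonoidHom.mem_ker, _root_.map_mul, _root_.map_inv, h, mul_inv_cancel]))
  refine ⟨c, ?_⟩
  rw [hc, ← _root_.map_mul, Units.val_mul, mul_assoc, Units.inv_mul, mul_one]

section

variable {L : Type*} [Field L] [Algebra F L] (ι : L →ₐ[F] D)

/-- The residue field of `L`, inside the residue field of `D`. -/
abbrev resRange : IntermediateField k K := r.resField ι.range (inv_mem_range ι)

/-- Bounding `[L : F]` and `[C : F]` from above and their product from below forces equality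
throughout. -/
theorem finrank_relations [Algebra.IsSeparable k K] [FiniteDimensional F L] [IsGalois F L]
    (hn : Module.finrank k K ^ 2 = Module.finrank F D) :
    Module.finrank F L =
      Module.finrank k (r.resRange ι) * Nat.card (r.thetaGroup ι.range (inv_mem_range ι)) ∧
    Module.finrank F L ∣ Module.finrank F D ∧
    r.thetaGroup (centralizerRange ι) (inv_mem_centralizerRange ι) =
      (r.resRange ι).fixingSubgroup := by
  have := finiteDimensional_of_sq_finrank hn
  have := r.isGalois
  have hsurj := r.theta_surjective
  have h1 := finrank_le_finrank_mul_finrank_centralizerRange ι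
  have h2 := r.finrank_le_finrank_resField_mul_card ι.range (inv_mem_range ι) hsurj hn
  have h3 := r.finrank_le_finrank_resField_mul_card _ (inv_mem_centralizerRange ι) hsurj hn
  have hL : Module.finrank F ι.range = Module.finrank F L :=
    ((AlgEquiv.ofInjective ι ι.injective).toLinearEquiv.finrank_eq).symm
  rw [hL] at h2
  have h4 : Module.finrank k (r.resField _ (inv_mem_centralizerRange ι)) *
      Nat.card (r.thetaGroup ι.range (inv_mem_range ι)) ≤ Module.finrank k K := by
    rw [← IntermediateField.finrank_fixedField_eq_card,
      ← Module.finrank_mul_finrank k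
        (IntermediateField.fixedField (r.thetaGroup ι.range (inv_mem_range ι))) K]
    refine Nat.mul_le_mul_right _ (IntermediateField.finrank_le_of_le_right ?_)
    rintro _ ⟨c, hc, hvc, rfl⟩
    rw [IntermediateField.mem_fixedField_iff]
    rintro _ ⟨x, hx, rfl⟩
    rw [r.theta_toFun x hvc, (Subalgebra.mem_centralizer_iff F).1 hc _ hx, mul_assoc, Units.mul_inv,
      mul_one]
  have h5 : r.thetaGroup _ (inv_mem_centralizerRange ι) ≤ (r.resRange ι).fixingSubgroup := by
    rintro _ ⟨x, hx, rfl⟩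
    rw [IntermediateField.mem_fixingSubgroup_iff]
    rintro _ ⟨a, ha, hva, rfl⟩
    rw [r.theta_toFun x hva, ← (Subalgebra.mem_centralizer_iff F).1 hx _ ha, mul_assoc, Units.mul_inv,
      mul_one]
  have h6 : Module.finrank k (r.resRange ι) * Nat.card (r.resRange ι).fixingSubgroup =
      Module.finrank k K := by
    rw [← IntermediateField.finrank_fixedField_eq_card, IsGalois.fixedField_fixingSubgroup,
      Module.finrank_mul_finrank]
  have h7 : Nat.card (r.thetaGroup _ (inv_mem_centralizerRange ι)) ≤
      Nat.card (r.resRange ι).fixingSubgroup := Subgroup.card_le_of_le h5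
  have hc : 0 < Module.finrank F (centralizerRange ι) := Module.finrank_pos
  have hf : 0 < Module.finrank k (r.resRange ι) := Module.finrank_pos
  have hnpos : 0 < Module.finrank k K := Module.finrank_pos
  rw [← hn] at h1 ⊢
  generalize hg : Nat.card (r.thetaGroup _ (inv_mem_centralizerRange ι)) = g at *
  generalize hm : Nat.card (r.resRange ι).fixingSubgroup = m at *
  generalize Nat.card (r.thetaGroup ι.range (inv_mem_range ι)) = e at *
  generalize Module.finrank k (r.resField _ (inv_mem_centralizerRange ι)) = c' at *
  generalize Module.finrank F (centralizerRange ι) = c at *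
  generalize Module.finrank F L = a at *
  generalize Module.finrank k (r.resRange ι) = f at *
  generalize Module.finrank k K = n at *
  -- The chain is `n² ≤ ac ≤ fec ≤ fe·c'g ≤ fgn ≤ fmn = n²`, with `c'e ≤ n` from `C̄ ⊆ K^θ(L)` and
  -- `g ≤ m` from `θ(C) ⊆ Gal(K/L̄)`.
  have i1 : a * c ≤ f * e * c := Nat.mul_le_mul_right _ h2
  have i2 : f * e * c ≤ f * e * (c' * g) := Nat.mul_le_mul_left _ h3
  have i3 : f * e * (c' * g) ≤ f * g * n :=
    calc f * e * (c' * g) = f * g * (c' * e) := by ring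
      _ ≤ _ := Nat.mul_le_mul_left _ h4
  have i4 : f * g * n ≤ f * m * n := Nat.mul_le_mul_right _ (Nat.mul_le_mul_left _ h7)
  have i5 : f * m * n = n ^ 2 := by rw [h6, sq]
  refine ⟨Nat.eq_of_mul_eq_mul_right hc (by omega), ⟨c, by omega⟩, ?_⟩
  refine Subgroup.eq_of_le_of_card_ge h5 ?_
  rw [hg, hm]
  refine Nat.le_of_mul_le_mul_right (Nat.le_of_mul_le_mul_left ?_ hf) hnpos
  rw [← mul_assoc, ← mul_assoc]
  omega

/-- Every automorphism of `K / k` is induced by an element normalizing `L`. -/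
theorem exists_mem_inducingPairs_theta_eq [Algebra.IsSeparable k K] [FiniteDimensional F L]
    [IsGalois F L] (hn : Module.finrank k K ^ 2 = Module.finrank F D) (g : K ≃ₐ[k] K) :
    ∃ q ∈ inducingPairs ι, r.theta q.2 = g := by
  have := finiteDimensional_of_sq_finrank hn
  have := r.isGalois
  let H : Subgroup (K ≃ₐ[k] K) := (inducingPairs ι).map (r.theta.comp (MonoidHom.snd _ _))
  suffices h : H = ⊤ from (h ▸ Subgroup.mem_top g : g ∈ H)
  rw [← IntermediateField.fixingSubgroup_fixedField H, ← IntermediateField.fixingSubgroup_bot]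
  congr 1
  refine eq_bot_iff.2 fun y hy => ?_
  rw [IntermediateField.mem_fixedField_iff] at hy
  -- The centralizer is part of the normalizer, and the fixed field of `θ(C)` is `L̄`. So `y` lifts
  -- to `L`, where the conjugates are Galois conjugates, all with residue `y`.
  have hyL : y ∈ r.resRange ι := by
    rw [← IsGalois.fixedField_fixingSubgroup (r.resRange ι), ← (r.finrank_relations ι hn).2.2,
      IntermediateField.mem_fixedField_iff]
    rintro _ ⟨x, hx, rfl⟩
    refine hy _ ⟨(1, x), fun a => ?_, rfl⟩
    exact ((Subalgebra.mem_centralizer_iff F).1 hx _ ⟨a, rfl⟩).symm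
  obtain ⟨_, ⟨a, rfl⟩, hva, rfl⟩ := hyL
  replace hva : v (ι a) ≤ 1 := hva
  refine IntermediateField.mem_bot.2 (r.mem_base_of_list_prod
    (Algebra.IsSeparable.isSeparable k _)
    ((Finset.univ : Finset (L ≃ₐ[F] L)).toList.map fun τ => ι (τ a)) ?_ ?_ ?_)
  · simp [Finset.univ_eq_empty_iff]
  · intro b hb
    obtain ⟨τ, -, rfl⟩ := List.mem_map.1 hb
    obtain ⟨x, hx⟩ := exists_mem_inducingPairs ι τ
    have h := conj_of_mem_inducingPairs hx a
    dsimp only at h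
    rw [← h]
    exact ⟨by rwa [v.map_conj], by rw [← r.theta_toFun x hva]; exact hy _ ⟨_, hx, rfl⟩⟩
  · intro i
    obtain ⟨c, hc⟩ := coeff_prod_X_sub_C_mem_range (F := F) a i
    refine ⟨c, ?_⟩
    rw [← ι.commutes, hc, ← ι.coe_toRingHom, ← coeff_map, ← Finset.prod_map_toList,
      Polynomial.map_list_prod, List.map_map, List.map_map]
    congr! 3
    ext τ : 1
    simp

end

end Reduction
end ValuedDivAlg

/-! ### Residues of commutators and Hilbert 90. -/

namespace ValuedDivAlg
namespace Reduction

variable {F : Type*} [Field F] {D : Type*} [DivisionRing D] [Algebra F D]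
    {Γ₀ : Type*} [LinearOrderedCommGroupWithZero Γ₀] {v : Valuation D Γ₀}
    {k K : Type*} [Field k] [Field K] [Algebra k K] (r : Reduction F v k K)

theorem v_commutator (x z : Dˣ) : v ((x * z * x⁻¹ * z⁻¹ : Dˣ) : D) = 1 := by
  rw [Units.val_mul, Units.val_mul, Units.val_mul, _root_.map_mul, v.map_conj,
    Units.val_inv_eq_inv_val, map_inv₀, mul_inv_cancel₀ (v.ne_zero_iff.2 z.ne_zero)]

/-- The residue of the commutator `x z x⁻¹ z⁻¹`. -/
noncomputable def commRes (x z : Dˣ) : Kˣ :=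
  Units.mk0 (r.toFun ((x * z * x⁻¹ * z⁻¹ : Dˣ) : D))
    ((r.ne_zero_iff (v_commutator x z).le).2 (v_commutator x z))

theorem val_commRes (x z : Dˣ) :
    (r.commRes x z : K) = r.toFun ((x * z * x⁻¹ * z⁻¹ : Dˣ) : D) := rfl

theorem commRes_eq_one_of_commute {x z : Dˣ} (h : Commute x z) : r.commRes x z = 1 := by
  ext
  rw [val_commRes, h.eq, mul_inv_cancel_right, mul_inv_cancel]
  exact r.map_one

/-- The identity `[xy, z] = x[y, z]x⁻¹ · [x, z]`; it is the source of the cocycle condition. -/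
theorem commRes_mul (x y z : Dˣ) :
    (r.commRes (x * y) z : K) = r.theta x (r.commRes y z) * r.commRes x z := by
  rw [val_commRes, val_commRes, val_commRes, r.theta_toFun x (v_commutator y z).le,
    ← r.map_mul (by rw [v.map_conj]; exact (v_commutator y z).le) (v_commutator x z).le]
  simp only [← Units.val_mul]
  congr 2
  group

theorem commRes_swap (x z : Dˣ) : r.commRes z x = (r.commRes x z)⁻¹ := by
  ext
  rw [Units.val_inv_eq_inv_val, val_commRes, val_commRes, ← r.map_inv (v_commutator x z),
    ← Units.val_inv_eq_inv_val]
  congr 2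
  group

theorem commRes_of_v_eq_one {u : Dˣ} (hu : v (u : D) = 1) (z : Dˣ) :
    (r.commRes u z : K) = r.toFun u * (r.theta z (r.toFun u))⁻¹ := by
  have hu' : v ((u⁻¹ : Dˣ) : D) = 1 := by rw [Units.val_inv_eq_inv_val, map_inv₀, hu, inv_one]
  have h : ((u * z * u⁻¹ * z⁻¹ : Dˣ) : D) = u * (z * (u⁻¹ : Dˣ) * (z⁻¹ : Dˣ)) := by
    simp [mul_assoc]
  rw [val_commRes, h, r.map_mul hu.le (by rw [v.map_conj, hu']), ← r.theta_toFun z hu'.le,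
    Units.val_inv_eq_inv_val, r.map_inv hu, map_inv₀]

/-- Write `y = u e x` with `e ∈ Fˣ` and `v u = 1`. The central `e` drops out, and `κ` is the residue
of `u`, the same for every `z`. -/
theorem exists_commRes_eq {x y : Dˣ} {c : F}
    (h : v (y : D) = v (algebraMap F D c) * v (x : D)) :
    r.theta y = r.theta x ∧ ∃ κ : Kˣ, ∀ z, (r.commRes y z : K) =
      r.commRes x z * (κ * (r.theta z (κ : K))⁻¹) := by
  have hc : algebraMap F D c ≠ 0 := fun h0 => by
    rw [h0, _root_.map_zero, zero_mul, v.zero_iff] at h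
    exact y.ne_zero h
  let e : Dˣ := Units.mk0 _ hc
  have hcen (z : Dˣ) : Commute e z := Units.ext (Algebra.commutes c (z : D))
  obtain ⟨u, hy⟩ : ∃ u : Dˣ, y = u * (e * x) := ⟨y * (e * x)⁻¹, by rw [inv_mul_cancel_right]⟩
  have hex : v ((e * x : Dˣ) : D) = v (y : D) := by rw [h, Units.val_mul, _root_.map_mul]; rfl
  have hu : v (u : D) = 1 := by
    have h1 : v (y : D) = v (u : D) * v ((e * x : Dˣ) : D) := by
      rw [← _root_.map_mul, ← Units.val_mul, ← hy]
    rw [hex] at h1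
    exact (mul_eq_right₀ (v.ne_zero_iff.2 y.ne_zero)).1 h1.symm
  have hte : r.theta e = 1 := r.theta_eq_one_of_commute fun d => Algebra.commutes c d
  refine ⟨?_, Units.mk0 (r.toFun u) ((r.ne_zero_iff hu.le).2 hu), fun z => ?_⟩
  · rw [hy, _root_.map_mul, _root_.map_mul, hte, r.theta_eq_one_of_v_eq_one hu, one_mul, one_mul]
  · rw [hy, commRes_mul, commRes_mul, hte, r.theta_eq_one_of_v_eq_one hu,
      r.commRes_eq_one_of_commute (hcen z), r.commRes_of_v_eq_one hu]
    simp

section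

variable {L : Type*} [Field L] [Algebra F L] (ι : L →ₐ[F] D)

/-- When `θ(x) = 1`, powers of `x` give powers of the commutator residue. As `x ^ [L : F]`
centralizes `L`, this residue is a `p ^ s`-th root of unity, and in characteristic `p` only `1` is.
-/
theorem commRes_eq_one_of_theta_eq_one (p : ℕ) [Fact p.Prime] [CharP K p] [FiniteDimensional F L]
    [IsGalois F L] {s : ℕ} (hL : Module.finrank F L = p ^ s) (z : Lˣ)
    {q : (L ≃ₐ[F] L) × Dˣ} (hq : q ∈ inducingPairs ι) (h : r.theta q.2 = 1) :
    r.commRes q.2 (Units.map (ι : L →* D) z) = 1 := by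
  have hpow (j : ℕ) : r.commRes (q.2 ^ j) (Units.map (ι : L →* D) z) =
      r.commRes q.2 (Units.map (ι : L →* D) z) ^ j := by
    induction j with
    | zero => rw [pow_zero, pow_zero]; exact r.commRes_eq_one_of_commute (Commute.one_left _)
    | succ j ih =>
      ext
      rw [pow_succ', commRes_mul, h, ih, pow_succ]
      rfl
  have hN := (inducingPairs ι).pow_mem hq (p ^ s)
  have h1 : (q ^ p ^ s).1 = 1 := by
    rw [Prod.pow_fst, ← hL, ← IsGalois.card_aut_eq_finrank, pow_card_eq_one']
  have h2 : r.commRes q.2 (Units.map (ι : L →* D) z) ^ p ^ s = 1 := by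
    rw [← hpow]
    refine r.commRes_eq_one_of_commute (Units.ext ?_)
    have := hN (z : L)
    rw [h1] at this
    exact this
  ext
  have h3 := congrArg Units.val h2
  rw [Units.val_pow_eq_pow_val, Units.val_one] at h3
  rw [Units.val_one, ← sub_eq_zero]
  refine eq_zero_of_pow_eq_zero (n := p ^ s) ?_
  rw [sub_pow_char_pow, h3, one_pow, sub_self]

variable [FiniteDimensional F D] [Algebra.IsCentral F D]

/-- For `z ∈ L` the commutators with elements normalizing `L` form a coboundary. -/
theorem exists_commRes_eq_coboundary (p : ℕ) [Fact p.Prime] [CharP K p] [Algebra.IsSeparable k K]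
    [FiniteDimensional F L] [IsGalois F L] (hn : Module.finrank k K ^ 2 = Module.finrank F D)
    (hdeg : ∃ n : ℕ, Module.finrank F D = (p ^ n) ^ 2) (z : Lˣ) :
    ∃ b : Kˣ, ∀ g : K ≃ₐ[k] K, ∃ x : Dˣ, r.theta x = g ∧
      (r.commRes x (Units.map (ι : L →* D) z) : K) = g b * (b : K)⁻¹ := by
  have := finiteDimensional_of_sq_finrank hn
  obtain ⟨s, hs⟩ : ∃ s, Module.finrank F L = p ^ s := by
    obtain ⟨n, hdeg⟩ := hdeg
    rw [← pow_mul] at hdeg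
    obtain ⟨s, -, hs⟩ := (Nat.dvd_prime_pow Fact.out).1 (hdeg ▸ (r.finrank_relations ι hn).2.1)
    exact ⟨s, hs⟩
  choose q hq hqg using r.exists_mem_inducingPairs_theta_eq ι hn
  set w : Dˣ := Units.map (ι : L →* D) z
  have hwell {q q' : (L ≃ₐ[F] L) × Dˣ} (hq : q ∈ inducingPairs ι) (hq' : q' ∈ inducingPairs ι)
      (h : r.theta q.2 = r.theta q'.2) : r.commRes q.2 w = r.commRes q'.2 w := by
    have hone : r.theta (q * q'⁻¹).2 = 1 := by
      rw [Prod.snd_mul, Prod.snd_inv, _root_.map_mul, _root_.map_inv, h, mul_inv_cancel]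
    have h1 := r.commRes_eq_one_of_theta_eq_one ι p hs z (mul_mem hq (inv_mem hq')) hone
    have h2 := r.commRes_mul (q * q'⁻¹).2 q'.2 w
    rw [hone, h1, ← Prod.snd_mul, inv_mul_cancel_right] at h2
    ext
    simpa using h2
  obtain ⟨b, hb⟩ := groupCohomology.isMulCoboundary₁_of_isMulCocycle₁_of_aut_to_units
    (fun g : K ≃ₐ[k] K => r.commRes (q g).2 w) fun g h => by
      ext
      have h1 := hwell (hq (g * h)) (mul_mem (hq g) (hq h)) (by
        rw [hqg, Prod.snd_mul, _root_.map_mul, hqg, hqg])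
      dsimp only
      rw [h1, Prod.snd_mul, commRes_mul, hqg]
      rfl
  refine ⟨b, fun g => ⟨(q g).2, hqg g, ?_⟩⟩
  have := congrArg Units.val (hb g)
  dsimp only at this
  rw [← this, Units.val_div_eq_div_val, div_eq_mul_inv]
  rfl

/-- If `[L : F]` is the degree of the residue extension of `L / F` then `Gal(K / k)` maps onto `Gal(L / F)`. -/
theorem exists_surjective_of_finrank_eq [Algebra.IsSeparable k K]
    [FiniteDimensional F L] [IsGalois F L] (hn : Module.finrank k K ^ 2 = Module.finrank F D)
    (h : Module.finrank F L = Module.finrank k (r.resRange ι)) :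
    ∃ φ : (K ≃ₐ[k] K) →* (L ≃ₐ[F] L), Function.Surjective φ := by
  have := finiteDimensional_of_sq_finrank hn
  have := r.isGalois
  let T : inducingPairs ι →* (L ≃ₐ[F] L) := (MonoidHom.fst _ _).comp (inducingPairs ι).subtype
  let Θ : inducingPairs ι →* (K ≃ₐ[k] K) :=
    (r.theta.comp (MonoidHom.snd _ _)).comp (inducingPairs ι).subtype
  have hT : Function.Surjective T := fun τ => by
    obtain ⟨x, hx⟩ := exists_mem_inducingPairs ι τ
    exact ⟨⟨_, hx⟩, rfl⟩
  have hΘ : Function.Surjective Θ := fun g => by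
    obtain ⟨q, hq, h⟩ := r.exists_mem_inducingPairs_theta_eq ι hn g
    exact ⟨⟨q, hq⟩, h⟩
  have hmap : T.ker.map Θ = (r.resRange ι).fixingSubgroup := by
    rw [← (r.finrank_relations ι hn).2.2]
    ext g
    constructor
    · rintro ⟨⟨⟨τ, x⟩, hq⟩, hτ, rfl⟩
      obtain rfl : τ = 1 := hτ
      refine ⟨x, (Subalgebra.mem_centralizer_iff F).2 ?_, rfl⟩
      rintro _ ⟨a, rfl⟩
      exact (hq a).symm
    · rintro ⟨x, hx, rfl⟩
      exact ⟨⟨(1, x), fun a => ((Subalgebra.mem_centralizer_iff F).1 hx _ ⟨a, rfl⟩).symm⟩, rfl, rfl⟩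
  -- `Θ` carries `ker T` onto `Gal(K/L̄)`, of index `[L̄ : k] = [L : F]`, which is also the index of
  -- `ker T`. Hence `ker Θ ≤ ker T`, and `T` factors through `Θ`.
  have hindex : (T.ker ⊔ Θ.ker).index = T.ker.index := by
    have h1 := Subgroup.index_map T.ker Θ
    rw [hmap, MonoidHom.range_eq_top.2 hΘ, Subgroup.index_top, mul_one] at h1
    have h2 := (r.resRange ι).fixingSubgroup.card_mul_index
    rw [IsGalois.card_fixingSubgroup_eq_finrank, IsGalois.card_aut_eq_finrank,
      ← Module.finrank_mul_finrank k (r.resRange ι) K, mul_comm] at h2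
    rw [← h1, Nat.eq_of_mul_eq_mul_right Module.finrank_pos h2, ← h, Subgroup.index_ker,
      MonoidHom.range_eq_top.2 hT, Subgroup.card_top, IsGalois.card_aut_eq_finrank]
  have hker : T.ker.index ≠ 0 := by
    rw [Subgroup.index_ker]; exact Nat.card_pos.ne'
  have hle : Θ.ker ≤ T.ker := by
    refine le_sup_right.trans (Subgroup.relIndex_eq_one.1 (?_ : T.ker.relIndex (T.ker ⊔ Θ.ker) = 1))
    have := Subgroup.relIndex_mul_index (le_sup_left : T.ker ≤ T.ker ⊔ Θ.ker)
    rw [hindex] at this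
    exact Nat.eq_of_mul_eq_mul_right (Nat.pos_of_ne_zero hker) (by rw [this, one_mul])
  refine ⟨Θ.liftOfSurjective hΘ ⟨T, hle⟩, fun τ => ?_⟩
  obtain ⟨q, rfl⟩ := hT τ
  exact ⟨Θ q, MonoidHom.liftOfRightInverse_comp_apply _ _ _ ⟨T, hle⟩ q⟩

end

end Reduction
end ValuedDivAlg

/-! ### Transfer to the residue rings of the statement. -/

namespace ValuedDivAlg

section Transfer

theorem _root_.RingHom.exists_ringEquiv_of_range_eq {R S T : Type*} [Ring R] [Ring S] [Ring T]
    {f : R →+* T} {g : S →+* T} (hf : Function.Injective f) (hg : Function.Injective g)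
    (h : f.range = g.range) : ∃ e : R ≃+* S, ∀ y, g (e y) = f y := by
  let e₁ : R ≃+* f.range := RingEquiv.ofBijective f.rangeRestrict
    ⟨fun x y hxy => hf (congrArg Subtype.val hxy), f.rangeRestrict_surjective⟩
  let e₂ : S ≃+* g.range := RingEquiv.ofBijective g.rangeRestrict
    ⟨fun x y hxy => hg (congrArg Subtype.val hxy), g.rangeRestrict_surjective⟩
  refine ⟨(e₁.trans (RingEquiv.subringCongr h)).trans e₂.symm, fun y => ?_⟩
  exact congrArg Subtype.val (e₂.apply_symm_apply _)

theorem isField_residue {F : Type*} [Field F] {Γ₀ : Type*} [LinearOrderedCommGroupWithZero Γ₀]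
    (w : Valuation F Γ₀) : IsField (Residue w) where
  exists_pair_ne := ⟨0, 1, fun h => by
    rw [eq_comm, ← map_one (residue w), Ideal.Quotient.eq_zero_iff_mem, mem_maxIdeal] at h
    simp at h⟩
  mul_comm := mul_comm
  mul_inv_cancel := by
    intro a ha
    obtain ⟨a, rfl⟩ := Ideal.Quotient.mk_surjective a
    have ha1 : w (a : F) = 1 := by
      rw [Ne, Ideal.Quotient.eq_zero_iff_mem, mem_maxIdeal, not_lt] at ha
      exact le_antisymm a.2 ha
    have h0 : (a : F) ≠ 0 := fun h => by simp [h] at ha1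
    refine ⟨residue w ⟨(a : F)⁻¹, by rw [Valuation.mem_integer_iff, map_inv₀, ha1, inv_one]⟩, ?_⟩
    rw [← map_mul, ← map_one (residue w)]
    exact congrArg _ (Subtype.ext (mul_inv_cancel₀ h0))

variable {F : Type*} [Field F] {D : Type*} [DivisionRing D] [Algebra F D]
  {Γ₀ : Type*} [LinearOrderedCommGroupWithZero Γ₀] {v : Valuation D Γ₀}

open Classical in
variable (F) in
/-- The reduction map given by the residue rings of `D` and `F`. -/
noncomputable def residueReduction (h : IsField (Residue v)) :
    letI := (isField_residue (restr F v)).toField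
    letI := h.toField
    Reduction F v (Residue (restr F v)) (Residue v) :=
  letI := (isField_residue (restr F v)).toField
  letI := h.toField
  { toFun := fun x => if hx : v x ≤ 1 then residue v ⟨x, hx⟩ else 0
    map_one := dif_pos (by simp)
    map_add := fun {x y} hx hy => by
      rw [dif_pos hx, dif_pos hy, dif_pos (v.map_add_le hx hy)]
      rfl
    map_mul := fun {x y} hx hy => by
      rw [dif_pos hx, dif_pos hy, dif_pos (by rw [_root_.map_mul]; exact mul_le_one' hx hy)]
      rfl
    eq_zero_iff := fun {x} hx => by
      rw [dif_pos hx]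
      exact Ideal.Quotient.eq_zero_iff_mem
    surj := fun y => by
      obtain ⟨x, rfl⟩ := Ideal.Quotient.mk_surjective y
      exact ⟨x, x.2, dif_pos x.2⟩
    mem_base_iff := fun y => by
      constructor
      · rintro ⟨c, rfl⟩
        obtain ⟨c, rfl⟩ := Ideal.Quotient.mk_surjective c
        exact ⟨c, c.2, dif_pos c.2⟩
      · rintro ⟨c, hc, rfl⟩
        exact by
          rw [dif_pos hc]
          exact ⟨residue (restr F v) ⟨c, hc⟩, rfl⟩ }

theorem residueReduction_toFun (h : IsField (Residue v)) (x : v.integer) :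
    letI := (isField_residue (restr F v)).toField
    letI := h.toField
    (residueReduction F h).toFun (x : D) = residue v x :=
  dif_pos x.2

namespace Reduction

variable {k K : Type*} [Field k] [Field K] [Algebra k K] (r : Reduction F v k K)

/-- A reduction map as a homomorphism on the valuation ring. -/
def toRingHom : v.integer →+* K where
  toFun x := r.toFun x
  map_one' := r.map_one
  map_mul' x y := r.map_mul x.2 y.2
  map_zero' := r.map_zero
  map_add' x y := r.map_add x.2 y.2

/-- A homomorphism `B → D` induces an embedding of the residue ring of `B` into `K`. -/
def comapResidue {B : Type*} [DivisionRing B] (f : B →+* D) : Residue (v.comap f) →+* K :=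
  Ideal.Quotient.lift _ (r.toRingHom.comp (f.restrict _ v.integer fun _ hx => hx))
    fun x hx => (r.eq_zero_iff x.2).2 hx

theorem comapResidue_injective {B : Type*} [DivisionRing B] (f : B →+* D) :
    Function.Injective (r.comapResidue f) := by
  refine (injective_iff_map_eq_zero _).2 fun y hy => ?_
  obtain ⟨x, rfl⟩ := Ideal.Quotient.mk_surjective y
  exact Ideal.Quotient.eq_zero_iff_mem.2 ((r.eq_zero_iff x.2).1 hy)

variable {L : Type*} [Field L] [Algebra F L] (ι : L →ₐ[F] D)

/-- The residue rings of `L` and `F` for the pulled-back valuation are quotients, not subfields of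
`K`. They are identified with `L̄` and `k` through their images in `K`, and degree and separability
are transported. -/
theorem isInertial_comap [FiniteDimensional F L] [Algebra.IsSeparable k K]
    (h : Module.finrank F L = Module.finrank k (r.resRange ι)) :
    IsInertial F (v.comap ι.toRingHom) := by
  let _ := (isField_residue (restr F (v.comap ι.toRingHom))).toField
  let w := v.comap ι.toRingHom
  have hv (c : F) : w (algebraMap F L c) = v (algebraMap F D c) := congrArg v (ι.commutes c)
  obtain ⟨j, hj⟩ : ∃ j : Residue w ≃+* r.resRange ι, ∀ y, (j y : K) = r.comapResidue _ y := by
    refine RingHom.exists_ringEquiv_of_range_eq (g := (r.resRange ι).val.toRingHom)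
      (r.comapResidue_injective _) Subtype.val_injective ?_
    ext y
    constructor
    · rintro ⟨y, rfl⟩
      obtain ⟨x, rfl⟩ := Ideal.Quotient.mk_surjective y
      exact ⟨⟨_, _, ⟨x, rfl⟩, x.2, rfl⟩, rfl⟩
    · rintro ⟨⟨_, _, ⟨a, rfl⟩, ha, rfl⟩, rfl⟩
      exact ⟨residue w ⟨a, ha⟩, rfl⟩
  let f : Residue (restr F w) →+* K := r.comapResidue (ι.toRingHom.comp (algebraMap F L))
  have hf (c : (restr F w).integer) : f (residue _ c) = r.toFun (algebraMap F D c) :=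
    congrArg r.toFun (ι.commutes c)
  obtain ⟨i, hi⟩ : ∃ i : Residue (restr F w) ≃+* k, ∀ y, algebraMap k K (i y) = f y := by
    refine RingHom.exists_ringEquiv_of_range_eq
      (r.comapResidue_injective _) (algebraMap k K).injective ?_
    ext y
    rw [r.mem_base_iff]
    constructor
    · rintro ⟨y, rfl⟩
      obtain ⟨c, rfl⟩ := Ideal.Quotient.mk_surjective y
      exact ⟨c, (hv c).symm.trans_le c.2, (hf c).symm⟩
    · rintro ⟨c, hc, rfl⟩
      exact ⟨residue _ ⟨c, (hv c).trans_le hc⟩, hf _⟩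
  have hij : (algebraMap k (r.resRange ι)).comp i.toRingHom =
      j.toRingHom.comp (algebraMap (Residue (restr F w)) (Residue w)) := by
    refine RingHom.ext fun y => Subtype.ext ((hi y).trans (Eq.trans ?_ (hj _).symm))
    obtain ⟨c, rfl⟩ := Ideal.Quotient.mk_surjective y
    rfl
  have : Algebra.IsSeparable k (r.resRange ι) :=
    Algebra.isSeparable_tower_bot_of_isSeparable k (r.resRange ι) K
  refine ⟨inferInstance, ?_, ?_⟩
  · rw [h]
    exact (Algebra.finrank_eq_of_equiv_equiv i j hij).symm
  · refine Algebra.IsSeparable.of_equiv_equiv i.symm j.symm (RingHom.ext fun y => ?_)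
    refine j.injective ?_
    have := RingHom.congr_fun hij (i.symm y)
    simp only [RingHom.comp_apply] at this ⊢
    exact this.symm.trans
      ((congrArg _ (i.apply_symm_apply y)).trans (j.apply_symm_apply _).symm)

end Reduction

end Transfer

end ValuedDivAlg

/-! ### Strong degeneracy and the conclusion. -/

namespace ValuedDivAlg

theorem map_monomial {G H : Type*} [Monoid G] [Monoid H] (f : G →* H) {r : ℕ} (x : Fin r → G)
    (m : Fin r → ℕ) : f (monomial x m) = monomial (fun i => f (x i)) m := by
  simp only [monomial, map_list_prod, List.map_ofFn, Function.comp_def, map_pow]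

namespace Reduction

variable {F : Type*} [Field F] {D : Type*} [DivisionRing D] [Algebra F D]
    {Γ₀ : Type*} [LinearOrderedCommGroupWithZero Γ₀] {v : Valuation D Γ₀}
    {k K : Type*} [Field k] [Field K] [Algebra k K] (r : Reduction F v k K)

theorem charP (r : Reduction F v k K) (p : ℕ) [Fact p.Prime] [CharP F p] : CharP K p := by
  rw [CharP.charP_iff_prime_eq_zero Fact.out, ← (r.map_natCast p).2,
    ← _root_.map_natCast (algebraMap F D), CharP.cast_eq_zero, _root_.map_zero, r.map_zero]

theorem exists_orderOf_theta_prime [FiniteDimensional k K] {L : Type*} [Field L] [Algebra F L]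
    (ι : L →ₐ[F] D) (hne : r.thetaGroup ι.range (inv_mem_range ι) ≠ ⊥) :
    ∃ z : Lˣ, (orderOf (r.theta (Units.map (ι : L →* D) z))).Prime := by
  have hp := Nat.minFac_prime (mt Subgroup.card_eq_one.1 hne)
  have := Fact.mk hp
  obtain ⟨g, hg⟩ := exists_prime_orderOf_dvd_card' _ (Nat.minFac_dvd
    (Nat.card (r.thetaGroup ι.range (inv_mem_range ι))))
  obtain ⟨x, ⟨a, ha⟩, hx⟩ := g.2
  have ha0 : a ≠ 0 := by
    rintro rfl
    exact x.ne_zero (ha.symm.trans (_root_.map_zero ι))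
  refine ⟨Units.mk0 a ha0, ?_⟩
  rw [show Units.map (ι : L →* D) (Units.mk0 a ha0) = x from Units.ext ha]
  rwa [hx, Subgroup.orderOf_coe, hg]

end Reduction

/-- A Galois subfield whose value group acts nontrivially on the residue field makes `D` strongly
degenerate. -/
theorem isStronglyDegenerate_of_thetaGroup_ne_bot (p : ℕ) [Fact p.Prime]
    {F : Type*} [Field F] [CharP F p]
    {D : Type*} [DivisionRing D] [Algebra F D] [FiniteDimensional F D] [Algebra.IsCentral F D]
    (hdeg : ∃ n : ℕ, Module.finrank F D = (p ^ n) ^ 2)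
    {Γ₀ : Type*} [LinearOrderedCommGroupWithZero Γ₀] {v : Valuation D Γ₀}
    (hram : IsSemiramified F v)
    (hsep : Algebra.IsSeparable (Residue (restr F v)) (Residue v))
    {L : Type*} [Field L] [Algebra F L] [FiniteDimensional F L] [IsGalois F L] (ι : L →ₐ[F] D)
    (hne : letI := (isField_residue (restr F v)).toField
      letI := hram.1.toField
      (residueReduction F hram.1).thetaGroup ι.range (inv_mem_range ι) ≠ ⊥) :
    IsStronglyDegenerate F v := by
  let _ := (isField_residue (restr F v)).toField
  let _ := hram.1.toField
  have : Algebra.IsSeparable (Residue (restr F v)) (Residue v) := hsep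
  have := Reduction.finiteDimensional_of_sq_finrank (F := F) (D := D) (k := Residue (restr F v))
    (K := Residue v) hram.2.2
  set r := residueReduction F hram.1
  have : CharP (Residue v) p := r.charP p
  obtain ⟨z, hz⟩ : ∃ z : Lˣ, (orderOf (r.theta (Units.map (ι : L →* D) z))).Prime :=
    r.exists_orderOf_theta_prime ι hne
  obtain ⟨b, hb⟩ := r.exists_commRes_eq_coboundary ι p hram.2.2 hdeg z
  set w : Dˣ := Units.map (ι : L →* D) z
  intro n σ π hσ hπ
  have hθ (i) : r.theta (π i) = σ i := by
    ext y
    obtain ⟨d, rfl⟩ := Ideal.Quotient.mk_surjective y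
    rw [hπ i d, ← residueReduction_toFun (F := F) hram.1 d, ← residueReduction_toFun (F := F) hram.1 (conj v (π i) d)]
    exact r.theta_toFun (π i) d.2
  obtain ⟨m, hm⟩ := hσ.2.2 (r.theta w)
  refine ⟨fun i => m i, ?_, ?_⟩
  · dsimp only at hm
    rwa [hm]
  dsimp only at hm
  set μ := monomial σ fun i => (m i : ℕ)
  set ϖ := monomial π fun i => (m i : ℕ)
  have hϖ : r.theta ϖ = r.theta w := by
    rw [← hm, map_monomial]
    simp only [hθ, μ]
  obtain ⟨c, hc⟩ := r.exists_v_eq_of_theta_eq hram.2.1 hϖ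
  obtain ⟨-, l, hl⟩ := r.exists_commRes_eq hc
  choose x hx hxb using fun i => hb (σ i)
  have hκ (i) : ∃ κ : (Residue v)ˣ, ∀ z, (r.commRes (π i) z : Residue v) =
      r.commRes (x i) z * (κ * (r.theta z (κ : Residue v))⁻¹) := by
    obtain ⟨c, hc⟩ := r.exists_v_eq_of_theta_eq hram.2.1 ((hθ i).trans (hx i).symm)
    exact (r.exists_commRes_eq hc).2
  choose κ hκ using hκ
  -- The coboundary `b` and the change `l` from `z` to `π^m` both contribute factors `σᵢ(·)/(·)`.
  -- The change from `xᵢ` to `πᵢ` contributes `κᵢ / σ^m(κᵢ)`, hence `kᵢ = κᵢ⁻¹`.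
  refine ⟨b * l, fun i => (κ i)⁻¹, fun i => ?_⟩
  have h1 : residue v (commInt v (π i) ϖ) = r.commRes (π i) ϖ :=
    (residueReduction_toFun (F := F) hram.1 (commInt v (π i) ϖ)).symm
  have h2 := hl (π i)
  rw [hθ] at h2
  have h3 : (r.commRes (π i) ϖ : Residue v) =
      r.commRes (π i) w * (σ i (l : Residue v) * (l : Residue v)⁻¹) := by
    rw [r.commRes_swap, Units.val_inv_eq_inv_val, h2, r.commRes_swap (π i) w,
      Units.val_inv_eq_inv_val, mul_inv, mul_inv, inv_inv, inv_inv, mul_comm (l : Residue v)⁻¹]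
  rw [h1, h3, hκ, hxb, hm]
  simp only [Units.val_mul, Units.val_inv_eq_inv_val, map_mul, map_inv₀, inv_inv, mul_inv]
  ring

end ValuedDivAlg

open ValuedDivAlg in
theorem theorem1p4 (p : ℕ) [Fact p.Prime] {F : Type*} [Field F] [CharP F p]
    {D : Type*} [DivisionRing D] [Algebra F D] [FiniteDimensional F D] [Algebra.IsCentral F D]
    (hdeg : ∃ n : ℕ, Module.finrank F D = (p ^ n) ^ 2)
    {Γ₀ : Type*} [LinearOrderedCommGroupWithZero Γ₀] (v : Valuation D Γ₀)
    (hens : HenselianLocalRing (restr F v).integer)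
    (hram : IsSemiramified F v)
    (hsep : Algebra.IsSeparable (Residue (restr F v)) (Residue v))
    (hnsd : ¬ IsStronglyDegenerate F v)
    {L : Type*} [Field L] [Algebra F L] [IsGalois F L] (ι : L →ₐ[F] D) :
    IsInertial F (v.comap ι.toRingHom) ∧
      ∃ φ : ResidueGal F v →* (L ≃ₐ[F] L), Function.Surjective φ := by
  have : FiniteDimensional F L := FiniteDimensional.of_injective ι.toLinearMap ι.injective
  have h := not_imp_comm.1 (isStronglyDegenerate_of_thetaGroup_ne_bot p hdeg hram hsep ι) hnsd
  let _ := (isField_residue (restr F v)).toField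
  let _ := hram.1.toField
  have : Algebra.IsSeparable (Residue (restr F v)) (Residue v) := hsep
  let r := residueReduction F hram.1
  have hrel := (r.finrank_relations ι hram.2.2).1
  have hcard : Nat.card (r.thetaGroup ι.range (inv_mem_range ι)) = 1 := Subgroup.card_eq_one.2 h
  rw [hcard, mul_one] at hrel
  exact ⟨r.isInertial_comap ι hrel, r.exists_surjective_of_finrank_eq ι hram.2.2 hrel⟩
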